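/- Let $M$ be a smooth manifold of dimension $n$, $\Pi$ a smooth bivector field, $R$ a smooth 3-vector field, $S$ a smooth 3-form and $H$ a smooth 4-form on $M$. The tuple $(M,\Pi,R,S,H)$ is called a bi-twisted $R$-Poisson manifold if $$\tfrac12[\Pi,\Pi]=R+\langle\Pi\otimes\Pi\otimes\Pi,S\rangle ,\qquad \mathrm dS=-H ,$$ where, in local coordinates, $[\Pi,\Pi]=\Pi^{il}\partial_l\Pi^{jk}\,\partial_i\wedge\partial_j\wedge\partial_k$ is the Schouten–Nijenhuis bracket and $\langle\Pi\otimes\Pi\otimes\Pi,S\rangle^{ijk}=\Pi^{il}\Pi^{jm}\Pi^{kr}S_{lmr}$ (summation over repeated indices is understood, $\partial_i=\partial/\partial x^i$, and $R=\frac1{3!}R^{ijk}\partial_i\wedge\partial_j\wedge\partial_k$, similarly for the other tensors). Let $(x^i,a_i,y^i,z_i)$, of degrees $0,1,1,2$, be the coordinates on the graded manifold $T^*[2]T^*[1]M$ induced by local coordinates $x^i$ of $M$; its functions over a coordinate domain are the polynomials in the graded-commuting variables $a,y,z$ with coefficients that are smooth functions of $x$. Put $\Theta=\langle\Pi,S\rangle$,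 i.e. $\Theta^i_{jk}=\Pi^{il}S_{ljk}$, and let $Q_+$ be the vector field given in every such coordinate system by $$\begin{aligned} Q_+={}&\bigl(\Pi^{ji}a_j-y^i\bigr)\partial_{x^i} +\Bigl(-\tfrac12\partial_i\Pi^{jk}a_ja_k+z_i+\tfrac12\Pi^{jm}\Theta^k_{mi}a_ka_j-\Theta^k_{ij}y^ja_k+\tfrac12S_{ijk}y^jy^k\Bigr)\partial_{a_i}\\ &+\Bigl(\Pi^{ji}z_j-\partial_j\Pi^{ik}a_ky^j+\tfrac12R^{ijk}a_ja_k+\Pi^{jm}\Theta^i_{mk}a_jy^k-\tfrac12\Theta^i_{jk}y^jy^k\Bigr)\partial_{y^i}\\ &+\Bigl(\partial_i\Pi^{jk}a_kz_j-\tfrac12\partial_i\partial_j\Pi^{kl}y^ja_ka_l+\tfrac1{3!}\partial_iR^{jkl}a_ja_ka_l +\tfrac12\partial_i(\Pi^{km}\Theta^j_{ml})y^la_ja_k-\tfrac12\partial_i\Theta^k_{jm}y^jy^ma_k\\ &\qquad+\tfrac1{3!}\partial_iS_{jkl}y^jy^ky^l +\tfrac1{3!}H_{ijkl}(y^j+\Pi^{jm}a_m)(y^k+\Pi^{kp}a_p)(y^l+\Pi^{lq}a_q)\Bigr)\partial_{z_i}.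 \end{aligned}$$ Then $(T^*[2]T^*[1]M,Q_+)$ is a $Q$-manifold, i.e. in every such coordinate system $Q_+$ is of degree $1$ and $Q_+^2=0$ on functions, if and only if $(M,\Pi,R,S,H)$ is a bi-twisted $R$-Poisson manifold. -/

import Mathlib

open scoped Manifold ContDiff TensorProduct
open TopologicalSpace

noncomputable section

namespace BiTwisted

/-! ### Smooth functions of the coordinates `x¹, …, xⁿ` on an open subset of `ℝⁿ` -/

/-- The model space `ℝⁿ`. -/
abbrev Coords (n : ℕ) : Type := EuclideanSpace ℝ (Fin n)

/-- The coordinate vector `∂/∂xⁱ` of `ℝⁿ`. -/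
def coordVec {n : ℕ} (i : Fin n) : Coords n := EuclideanSpace.single i 1

/-- The algebra `C^∞(U)` of smooth real functions on an open set `U ⊆ ℝⁿ`. -/
def SmoothFun {n : ℕ} (U : Opens (Coords n)) : Subalgebra ℝ (U → ℝ) where
  carrier := {f | ∃ g : Coords n → ℝ, ContDiffOn ℝ ∞ g U ∧ ∀ u : U, f u = g u}
  mul_mem' := by
    rintro f₁ f₂ ⟨g₁, h₁, e₁⟩ ⟨g₂, h₂, e₂⟩
    exact ⟨fun u => g₁ u * g₂ u, h₁.mul h₂, fun u => by simp [e₁, e₂]⟩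
  add_mem' := by
    rintro f₁ f₂ ⟨g₁, h₁, e₁⟩ ⟨g₂, h₂, e₂⟩
    exact ⟨fun u => g₁ u + g₂ u, h₁.add h₂, fun u => by simp [e₁, e₂]⟩
  algebraMap_mem' := fun r => ⟨fun _ => r, contDiffOn_const, fun u => by simp⟩

namespace SmoothFun

variable {n : ℕ} {U : Opens (Coords n)}

/-- A function on `ℝⁿ` that is smooth on `U`, as an element of `C^∞(U)`. -/
def ofContDiffOn (g : Coords n → ℝ) (hg : ContDiffOn ℝ ∞ g U) : SmoothFun U :=
  ⟨fun u => g u, g, hg, fun _ => rfl⟩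

/-- A smooth function on `U`, extended by zero to a function on `ℝⁿ`. -/
def ext (f : SmoothFun U) : Coords n → ℝ := Function.extend Subtype.val (f : U → ℝ) 0

theorem ext_apply (f : SmoothFun U) (u : U) : ext f u = (f : U → ℝ) u :=
  Subtype.val_injective.extend_apply _ _ _

theorem contDiffOn_ext (f : SmoothFun U) : ContDiffOn ℝ ∞ (ext f) U := by
  obtain ⟨g, hg, e⟩ := f.2
  refine hg.congr fun u hu => ?_
  exact (ext_apply f ⟨u, hu⟩).trans (e ⟨u, hu⟩)

theorem differentiableAt_ext (f : SmoothFun U) (u : U) : DifferentiableAt ℝ (ext f) u :=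
  ((contDiffOn_ext f).contDiffAt (U.isOpen.mem_nhds u.2)).differentiableAt (by simp)

theorem fderiv_ext_congr (f : SmoothFun U) (g : Coords n → ℝ) (u : U)
    (h : ∀ v : U, (f : U → ℝ) v = g v) : fderiv ℝ (ext f) u = fderiv ℝ g u := by
  refine Filter.EventuallyEq.fderiv_eq ?_
  filter_upwards [U.isOpen.mem_nhds u.2] with v hv
  exact (ext_apply f ⟨v, hv⟩).trans (h ⟨v, hv⟩)

/-- The partial derivative `∂/∂xⁱ`, as a derivation of `C^∞(U)`. -/
def pd (i : Fin n) : Derivation ℝ (SmoothFun U) (SmoothFun U) :=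
  Derivation.mk'
    { toFun := fun f => ⟨fun u => fderiv ℝ (ext f) u (coordVec i),
        fun u => fderiv ℝ (ext f) u (coordVec i),
        ((contDiffOn_ext f).fderiv_of_isOpen U.isOpen (by simp)).clm_apply contDiffOn_const,
        fun _ => rfl⟩
      map_add' := fun f g => by
        ext u
        have h := fderiv_ext_congr (f + g) (fun v => ext f v + ext g v) u
          (fun v => by simp [ext_apply])
        simp [h, fderiv_fun_add (differentiableAt_ext f u) (differentiableAt_ext g u)]
      map_smul' := fun r f => by
        ext u
        have h := fderiv_ext_congr (r • f) (fun v => r * ext f v) u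
          (fun v => by simp [ext_apply])
        simp [h, fderiv_const_mul (differentiableAt_ext f u)] }
    (fun f g => by
      ext u
      have h := fderiv_ext_congr (f * g) (fun v => ext f v * ext g v) u
        (fun v => by simp [ext_apply])
      simp [h, fderiv_fun_mul (differentiableAt_ext f u) (differentiableAt_ext g u), ext_apply])

end SmoothFun

/-! ### The graded manifold `T*[2]T*[1]U` over a coordinate domain `U`

Its coordinates are `xⁱ` (degree 0), `aᵢ` and `yⁱ` (degree 1) and `zᵢ` (degree 2). -/

/-- The exterior algebra on the odd coordinates `aᵢ` (index `inl i`) and `yⁱ` (index `inr i`). -/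
abbrev OddAlg (n : ℕ) : Type := ExteriorAlgebra ℝ (Fin n ⊕ Fin n → ℝ)

/-- Functions of the coordinates of positive degree with constant coefficients: the free
graded-commutative algebra `ℝ[z] ⊗ Λ(a, y)`. -/
abbrev FibreAlg (n : ℕ) : Type := MvPolynomial (Fin n) ℝ ⊗[ℝ] OddAlg n

/-- The functions on `T*[2]T*[1]U`: polynomials in `a, y, z` with coefficients in `C^∞(U)`. -/
abbrev SuperFun {n : ℕ} (U : Opens (Coords n)) : Type := SmoothFun U ⊗[ℝ] FibreAlg n

instance (n : ℕ) : Ring (FibreAlg n) := Algebra.TensorProduct.instRing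

instance {n : ℕ} (U : Opens (Coords n)) : Ring (SuperFun U) := Algebra.TensorProduct.instRing

section Superfunctions

variable {n : ℕ} (U : Opens (Coords n))

/-- A function of `x` as a function on `T*[2]T*[1]U`. -/
def base {U : Opens (Coords n)} : SmoothFun U →ₐ[ℝ] SuperFun U :=
  Algebra.TensorProduct.includeLeft

/-- The degree-1 coordinate `aᵢ`. -/
def a (i : Fin n) : SuperFun U :=
  (1 : SmoothFun U) ⊗ₜ[ℝ] ((1 : MvPolynomial (Fin n) ℝ) ⊗ₜ[ℝ]
    ExteriorAlgebra.ι ℝ (Pi.single (Sum.inl i) (1 : ℝ)))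

/-- The degree-1 coordinate `yⁱ`. -/
def y (i : Fin n) : SuperFun U :=
  (1 : SmoothFun U) ⊗ₜ[ℝ] ((1 : MvPolynomial (Fin n) ℝ) ⊗ₜ[ℝ]
    ExteriorAlgebra.ι ℝ (Pi.single (Sum.inr i) (1 : ℝ)))

/-- The degree-2 coordinate `zᵢ`. -/
def z (i : Fin n) : SuperFun U :=
  (1 : SmoothFun U) ⊗ₜ[ℝ] ((MvPolynomial.X i : MvPolynomial (Fin n) ℝ) ⊗ₜ[ℝ] (1 : OddAlg n))

/-- `∂/∂xⁱ`. -/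
def dx (i : Fin n) : SuperFun U →ₗ[ℝ] SuperFun U :=
  LinearMap.rTensor (FibreAlg n) (SmoothFun.pd i).toLinearMap

/-- `∂/∂zᵢ`. -/
def dz (i : Fin n) : SuperFun U →ₗ[ℝ] SuperFun U :=
  LinearMap.lTensor (SmoothFun U) (LinearMap.rTensor (OddAlg n)
    (MvPolynomial.pderiv (R := ℝ) i).toLinearMap)

/-- The left derivative with respect to the odd coordinate with index `s`: the antiderivation
with `∂(θ w) = ∂(θ) w - θ ∂(w)` for every odd coordinate `θ`. -/
def dodd (s : Fin n ⊕ Fin n) : SuperFun U →ₗ[ℝ] SuperFun U :=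
  LinearMap.lTensor (SmoothFun U) (LinearMap.lTensor (MvPolynomial (Fin n) ℝ)
    (CliffordAlgebra.contractLeft (Q := (0 : QuadraticForm ℝ (Fin n ⊕ Fin n → ℝ)))
      (LinearMap.proj s : Module.Dual ℝ (Fin n ⊕ Fin n → ℝ))))

/-- The left derivative `∂/∂aᵢ`. -/
def da (i : Fin n) : SuperFun U →ₗ[ℝ] SuperFun U := dodd U (Sum.inl i)

/-- The left derivative `∂/∂yⁱ`. -/
def dy (i : Fin n) : SuperFun U →ₗ[ℝ] SuperFun U := dodd U (Sum.inr i)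

/-- The functions of degree `k`, where `x, a, y, z` have degrees `0, 1, 1, 2`. -/
def degreePart (k : ℕ) : Submodule ℝ (SuperFun U) :=
  Submodule.span ℝ {F | ∃ m r : ℕ, 2 * m + r = k ∧ ∃ f : SmoothFun U,
    ∃ p ∈ MvPolynomial.homogeneousSubmodule (Fin n) ℝ m,
    ∃ w ∈ ⋀[ℝ]^r (Fin n ⊕ Fin n → ℝ), F = f ⊗ₜ[ℝ] (p ⊗ₜ[ℝ] (w : OddAlg n))}

/-- A vector field on `T*[2]T*[1]U`, given by its components along
`∂/∂xⁱ, ∂/∂aᵢ, ∂/∂yⁱ, ∂/∂zᵢ`. -/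
structure SuperVectorField where
  /-- the components along `∂/∂xⁱ` -/
  X : Fin n → SuperFun U
  /-- the components along `∂/∂aᵢ` -/
  A : Fin n → SuperFun U
  /-- the components along `∂/∂yⁱ` -/
  Y : Fin n → SuperFun U
  /-- the components along `∂/∂zᵢ` -/
  Z : Fin n → SuperFun U

variable {U}

/-- The action of a vector field on functions. -/
def SuperVectorField.act (V : SuperVectorField U) : SuperFun U →ₗ[ℝ] SuperFun U :=
  ∑ i, (LinearMap.mulLeft ℝ (V.X i) ∘ₗ dx U i + LinearMap.mulLeft ℝ (V.A i) ∘ₗ da U i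
    + LinearMap.mulLeft ℝ (V.Y i) ∘ₗ dy U i + LinearMap.mulLeft ℝ (V.Z i) ∘ₗ dz U i)

/-- A vector field has degree 1 if it raises the degree of every coordinate by 1. -/
def SuperVectorField.HasDegreeOne (V : SuperVectorField U) : Prop :=
  ∀ i, V.X i ∈ degreePart U 1 ∧ V.A i ∈ degreePart U 2 ∧ V.Y i ∈ degreePart U 2 ∧
    V.Z i ∈ degreePart U 3

/-- A homological vector field: a vector field of degree 1 whose square vanishes as an operator
on functions. -/
def SuperVectorField.IsHomological (V : SuperVectorField U) : Prop :=
  V.HasDegreeOne ∧ V.act ∘ₗ V.act = 0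

end Superfunctions

/-! ### The vector field `Q₊` in coordinates -/

section Qplus

variable {n : ℕ} {U : Opens (Coords n)}

/-- The components `Θⁱⱼₖ = Πⁱˡ Sₗⱼₖ` of the torsion `Θ = ⟨Π, S⟩`. -/
def torsion (P : Fin n → Fin n → SmoothFun U) (S : Fin n → Fin n → Fin n → SmoothFun U)
    (i j k : Fin n) : SmoothFun U :=
  ∑ l, P i l * S l j k

/-- The degree-1 vector field `Q` determined by a bivector and a trivector, without any
contribution of the forms. -/
def undeformedQ (P : Fin n → Fin n → SmoothFun U)
    (R : Fin n → Fin n → Fin n → SmoothFun U) : SuperVectorField U where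
  X i := ∑ j, base (P j i) * a U j
  A i := -∑ j, ∑ k, (1 / 2 : ℝ) • (base (SmoothFun.pd i (P j k)) * a U j * a U k)
  Y i := ∑ j, base (P j i) * z U j
    - ∑ j, ∑ k, base (SmoothFun.pd j (P i k)) * a U k * y U j
    + ∑ j, ∑ k, (1 / 2 : ℝ) • (base (R i j k) * a U j * a U k)
  Z i := ∑ j, ∑ k, base (SmoothFun.pd i (P j k)) * a U k * z U j
    - ∑ j, ∑ k, ∑ l,
        (1 / 2 : ℝ) • (base (SmoothFun.pd i (SmoothFun.pd j (P k l))) * y U j * a U k * a U l)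
    + ∑ j, ∑ k, ∑ l, (1 / 6 : ℝ) • (base (SmoothFun.pd i (R j k l)) * a U j * a U k * a U l)

/-- The degree-1 function `yⁱ + Πⁱʲ aⱼ`. -/
def shiftedY (P : Fin n → Fin n → SmoothFun U) (i : Fin n) : SuperFun U :=
  y U i + ∑ j, base (P i j) * a U j

/-- The deformed vector field `Q₊`. -/
def Qplus (P : Fin n → Fin n → SmoothFun U) (R S : Fin n → Fin n → Fin n → SmoothFun U)
    (H : Fin n → Fin n → Fin n → Fin n → SmoothFun U) : SuperVectorField U where
  X i := (undeformedQ P R).X i - y U i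
  A i := (undeformedQ P R).A i + z U i
    + ∑ j, ∑ k, ∑ m, (1 / 2 : ℝ) • (base (P j m * torsion P S k m i) * a U k * a U j)
    - ∑ j, ∑ k, base (torsion P S k i j) * y U j * a U k
    + ∑ j, ∑ k, (1 / 2 : ℝ) • (base (S i j k) * y U j * y U k)
  Y i := (undeformedQ P R).Y i
    + ∑ j, ∑ k, ∑ m, base (P j m * torsion P S i m k) * a U j * y U k
    - ∑ j, ∑ k, (1 / 2 : ℝ) • (base (torsion P S i j k) * y U j * y U k)
  Z i := (undeformedQ P R).Z i
    + ∑ j, ∑ k, ∑ m, ∑ l, (1 / 2 : ℝ) •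
        (base (SmoothFun.pd i (P k m * torsion P S j m l)) * y U l * a U j * a U k)
    - ∑ j, ∑ k, ∑ m, (1 / 2 : ℝ) •
        (base (SmoothFun.pd i (torsion P S k j m)) * y U j * y U m * a U k)
    + ∑ j, ∑ k, ∑ l, (1 / 6 : ℝ) • (base (SmoothFun.pd i (S j k l)) * y U j * y U k * y U l)
    + ∑ j, ∑ k, ∑ l, (1 / 6 : ℝ) •
        (base (H i j k l) * shiftedY P j * shiftedY P k * shiftedY P l)

/-! ### Tensor calculus in coordinates -/

/-- The components of the Schouten–Nijenhuis bracket
`[Π, Π] = Πⁱˡ ∂ₗ Πʲᵏ ∂ᵢ ∧ ∂ⱼ ∧ ∂ₖ` of a bivector with itself, where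
`∂₁ ∧ ∂₂ ∧ ∂₃` is the signed sum of the six permuted tensor products. -/
def schoutenSquare (P : Fin n → Fin n → SmoothFun U) (i : Fin 3 → Fin n) : SmoothFun U :=
  ∑ σ : Equiv.Perm (Fin 3), (Equiv.Perm.sign σ : ℤ) •
    ∑ l, P (i (σ 0)) l * SmoothFun.pd l (P (i (σ 1)) (i (σ 2)))

/-- The components `Πⁱˡ Πʲᵐ Πᵏʳ Sₗₘᵣ` of the trivector `⟨Π ⊗ Π ⊗ Π, S⟩`. -/
def contraction (P : Fin n → Fin n → SmoothFun U) (S : Fin n → Fin n → Fin n → SmoothFun U)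
    (i j k : Fin n) : SmoothFun U :=
  ∑ l, ∑ m, ∑ r, P i l * P j m * P k r * S l m r

end Qplus

/-! ### Multivector fields and differential forms on a manifold -/

section Manifold

variable {n : ℕ} {M : Type*} [TopologicalSpace M] [ChartedSpace (Coords n) M]

/-- The open subset of `ℝⁿ` that is the image of a chart. -/
def chartImage (e : OpenPartialHomeomorph M (Coords n)) : Opens (Coords n) :=
  ⟨e.target, e.open_target⟩

/-- The coordinate covector `dxⁱ` at the point of `M` with coordinates `u` in the chart `e`. -/
def coordCovector (e : OpenPartialHomeomorph M (Coords n)) (u : Coords n) (i : Fin n) :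
    TangentSpace (𝓡 n) (e.symm u) →L[ℝ] ℝ :=
  (EuclideanSpace.proj i : Coords n →L[ℝ] ℝ).comp (mfderiv (𝓡 n) (𝓡 n) e (e.symm u))

/-- The coordinate expression in the chart `e` of a field of alternating forms: its pullback
by the inverse of the chart. -/
def formInChart {k : ℕ} (β : ∀ x : M, TangentSpace (𝓡 n) x [⋀^Fin k]→L[ℝ] ℝ)
    (e : OpenPartialHomeomorph M (Coords n)) (u : Coords n) : Coords n [⋀^Fin k]→L[ℝ] ℝ :=
  (β (e.symm u)).compContinuousLinearMap (mfderiv (𝓡 n) (𝓡 n) e.symm u)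

variable (n M)

/-- A smooth `k`-vector field: an alternating `k`-linear form on each cotangent space whose
components are smooth in every chart. -/
structure MultivectorField (k : ℕ) where
  /-- the value at a point -/
  toFun : ∀ x : M, (TangentSpace (𝓡 n) x →L[ℝ] ℝ) [⋀^Fin k]→ₗ[ℝ] ℝ
  smooth : ∀ e ∈ IsManifold.maximalAtlas (𝓡 n) ∞ M, ∀ i : Fin k → Fin n,
    ContDiffOn ℝ ∞ (fun u => toFun (e.symm u) fun r => coordCovector e u (i r)) e.target

/-- A smooth differential `k`-form. -/
structure DifferentialForm (k : ℕ) where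
  /-- the value at a point -/
  toFun : ∀ x : M, TangentSpace (𝓡 n) x [⋀^Fin k]→L[ℝ] ℝ
  smooth : ∀ e ∈ IsManifold.maximalAtlas (𝓡 n) ∞ M, ContDiffOn ℝ ∞ (formInChart toFun e) e.target

variable {n M}

/-- The components of a multivector field in a chart. -/
def MultivectorField.comp {k : ℕ} (V : MultivectorField n M k)
    (e : IsManifold.maximalAtlas (𝓡 n) ∞ M) (i : Fin k → Fin n) :
    SmoothFun (chartImage e.1) :=
  SmoothFun.ofContDiffOn
    (fun u => V.toFun (e.1.symm u) fun r => coordCovector e.1 u (i r)) (V.smooth e.1 e.2 i)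

/-- The components of a differential form in a chart. -/
def DifferentialForm.comp {k : ℕ} (β : DifferentialForm n M k)
    (e : IsManifold.maximalAtlas (𝓡 n) ∞ M) (i : Fin k → Fin n) :
    SmoothFun (chartImage e.1) :=
  SmoothFun.ofContDiffOn
    (fun u => formInChart β.toFun e.1 u fun r => coordVec (i r))
    ((ContinuousAlternatingMap.apply ℝ (Coords n) ℝ fun r => coordVec (i r)).contDiff.comp_contDiffOn
      (β.smooth e.1 e.2))

/-- The vector field `Q₊` on `T*[2]T*[1]M` in the coordinates `(x, a, y, z)` induced by a
chart of `M`. -/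
def QplusInChart (P : MultivectorField n M 2) (R : MultivectorField n M 3)
    (S : DifferentialForm n M 3) (H : DifferentialForm n M 4)
    (e : IsManifold.maximalAtlas (𝓡 n) ∞ M) : SuperVectorField (chartImage e.1) :=
  Qplus (fun i j => P.comp e ![i, j]) (fun i j k => R.comp e ![i, j, k])
    (fun i j k => S.comp e ![i, j, k]) (fun i j k l => H.comp e ![i, j, k, l])

/-- `(T*[2]T*[1]M, Q₊)` is a `Q`-manifold: in the coordinates induced by any chart of `M`, the
vector field `Q₊` has degree 1 and squares to zero on all functions. -/
def IsQManifold (P : MultivectorField n M 2) (R : MultivectorField n M 3)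
    (S : DifferentialForm n M 3) (H : DifferentialForm n M 4) : Prop :=
  ∀ e : IsManifold.maximalAtlas (𝓡 n) ∞ M, (QplusInChart P R S H e).IsHomological

/-- `(M, Π, R, S, H)` is a bi-twisted `R`-Poisson manifold:
`½ [Π, Π] = R + ⟨Π ⊗ Π ⊗ Π, S⟩` and `dS = -H`. -/
structure IsBiTwistedRPoisson (P : MultivectorField n M 2) (R : MultivectorField n M 3)
    (S : DifferentialForm n M 3) (H : DifferentialForm n M 4) : Prop where
  half_schouten : ∀ (e : IsManifold.maximalAtlas (𝓡 n) ∞ M) (i j k : Fin n),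
    (1 / 2 : ℝ) • schoutenSquare (fun i j => P.comp e ![i, j]) ![i, j, k] =
      R.comp e ![i, j, k] +
        contraction (fun i j => P.comp e ![i, j]) (fun i j k => S.comp e ![i, j, k]) i j k
  extDeriv_eq : ∀ (e : IsManifold.maximalAtlas (𝓡 n) ∞ M), ∀ u ∈ e.1.target,
    extDeriv (formInChart S.toFun e.1) u = -formInChart H.toFun e.1 u

end Manifold

end BiTwisted

end

/-! Everything is local: both sides of the equivalence are quantified over charts, so the argument
runs in one chart at a time and never compares two of them.

The computation becomes short in terms of w^i = y^i + Π^{ij} a_j (`shiftedY`). Then Q₊x^i = -w^i,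
and in the other components the terms in S, Θ and ΠΘ complete to the square or cube of w: Q₊a_i =
z_i - ½ ∂_iΠ^{jk} a_j a_k + ½ S_{ijk} w^j w^k (`Qplus_A`), and similarly for y and z (`Qplus_Y`,
`Qplus_Z`). Completing the powers leaves pure a-terms which turn R into R + ⟨Π⊗Π⊗Π, S⟩.

With J = ½[Π,Π] written as a cyclic sum (`jacobiator`), cancellation gives Q₊²x^i = ½ (J - R -
⟨Π⊗Π⊗Π, S⟩)^{ijk} a_j a_k (`Qplus_act_X`). Once this vanishes, Q₊w = 0, and Q₊²a_i = (1/6) (H +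
dS)_{ijkl} w^j w^k w^l (`Qplus_act_A`).

For the direction from tensors to Q₊, the square of an odd derivation is a derivation
(`act_act_mul`), so it suffices that it vanishes on x, a, y, z. The first two are the formulas
above. The last two are free: Q₊² kills Q₊x = -(y + Πa) and Q₊a = z + (terms in x, a, w), hence also
y and z. No square of the long components Y and Z is ever computed (`Qplus_isHomological`).

Conversely, alternating coefficients are recovered from a quadratic or cubic expression by repeated
odd derivatives: ∂/∂a for the first formula, ∂/∂y for the second, because ∂w^i/∂y^j = δ^i_j
(`eq_zero_of_quad_eq_zero`, `eq_zero_of_cub_eq_zero`). -/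

noncomputable section

/-! ### Signs and contractions in the exterior algebra. -/

namespace ExteriorAlgebra

variable {R M : Type*} [CommRing R] [AddCommGroup M] [Module R M]

theorem ι_mul_eq_involute_mul (m : M) (v : ExteriorAlgebra R M) :
    ι R m * v = CliffordAlgebra.involute v * ι R m := by
  induction v using CliffordAlgebra.induction with
  | algebraMap r => rw [AlgHom.commutes, Algebra.commutes]
  | ι x =>
    rw [CliffordAlgebra.involute_ι]
    have h := ι_add_mul_swap (R := R) m x
    rw [neg_mul]
    exact eq_neg_of_add_eq_zero_left h
  | mul u v hu hv => rw [map_mul, ← mul_assoc, hu, mul_assoc, hv, mul_assoc]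
  | add u v hu hv => rw [map_add, mul_add, add_mul, hu, hv]

/-- Each of the r generators making up `w` costs one grading involution on passing `v`. Stating the
sign through `involute` means that only `w` has to be homogeneous. -/
theorem mul_eq_involute_iterate_mul {r : ℕ} {w : ExteriorAlgebra R M} (hw : w ∈ ⋀[R]^r M)
    (v : ExteriorAlgebra R M) : w * v = (CliffordAlgebra.involute)^[r] v * w := by
  induction hw using Submodule.pow_induction_on_left' generalizing v with
  | algebraMap c => rw [Function.iterate_zero_apply, Algebra.commutes]
  | add x y i hx hy ihx ihy => rw [add_mul, mul_add, ihx, ihy]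
  | mem_mul m hm i x hx ih =>
    obtain ⟨m, rfl⟩ := hm
    rw [mul_assoc, ih, ← mul_assoc, ι_mul_eq_involute_mul,
      ← Function.iterate_succ_apply' (CliffordAlgebra.involute : ExteriorAlgebra R M → _),
      mul_assoc]

theorem involute_of_mem {r : ℕ} {w : ExteriorAlgebra R M} (hw : w ∈ ⋀[R]^r M) :
    CliffordAlgebra.involute w = (-1 : R) ^ r • w := by
  induction hw using Submodule.pow_induction_on_left' with
  | algebraMap c => simp
  | add x y i hx hy ihx ihy => rw [map_add, ihx, ihy, smul_add]
  | mem_mul m hm i x hx ih =>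
    obtain ⟨m, rfl⟩ := hm
    rw [map_mul, ih]
    erw [CliffordAlgebra.involute_ι]
    rw [neg_mul, mul_smul_comm, pow_succ, mul_neg_one, neg_smul]

/-- For a single generator as left factor this is the defining recursion of the contraction; the
general rule follows by building `u` up from the left. -/
theorem contractLeft_mul (d : Module.Dual R M) (u v : ExteriorAlgebra R M) :
    CliffordAlgebra.contractLeft d (u * v) =
      CliffordAlgebra.contractLeft d u * v +
        CliffordAlgebra.involute u * CliffordAlgebra.contractLeft d v := by
  induction u using CliffordAlgebra.left_induction with
  | algebraMap r => simp [CliffordAlgebra.contractLeft_algebraMap_mul]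
  | add x y hx hy => simp only [add_mul, map_add, hx, hy]; abel
  | ι_mul x m hx =>
    rw [mul_assoc, CliffordAlgebra.contractLeft_ι_mul, hx, CliffordAlgebra.contractLeft_ι_mul,
      map_mul, CliffordAlgebra.involute_ι, sub_mul, mul_add, smul_mul_assoc, neg_mul, neg_mul]
    simp only [mul_assoc]
    abel

theorem involute_contractLeft (d : Module.Dual R M) (u : ExteriorAlgebra R M) :
    CliffordAlgebra.involute (CliffordAlgebra.contractLeft d u) =
      -CliffordAlgebra.contractLeft d (CliffordAlgebra.involute u) := by
  induction u using CliffordAlgebra.left_induction with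
  | algebraMap r => simp [CliffordAlgebra.contractLeft_algebraMap]
  | add x y hx hy => simp only [map_add, hx, hy]; abel
  | ι_mul x m hx =>
    rw [CliffordAlgebra.contractLeft_ι_mul, map_mul, CliffordAlgebra.involute_ι, neg_mul, map_neg,
      CliffordAlgebra.contractLeft_ι_mul, map_sub, map_mul, hx, CliffordAlgebra.involute_ι,
      map_smul]
    simp

end ExteriorAlgebra

/-! ### The coordinate derivatives as even and odd derivations of the superfunctions. -/

namespace BiTwisted

variable {n : ℕ} {U : Opens (Coords n)}

theorem SuperFun.induction {motive : SuperFun U → Prop} (F : SuperFun U) (zero : motive 0)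
    (tmul : ∀ (f : SmoothFun U) (p : MvPolynomial (Fin n) ℝ) (w : OddAlg n),
      motive (f ⊗ₜ[ℝ] (p ⊗ₜ[ℝ] w)))
    (add : ∀ F G, motive F → motive G → motive (F + G)) : motive F := by
  induction F using TensorProduct.induction_on with
  | zero => exact zero
  | add x y hx hy => exact add x y hx hy
  | tmul f g =>
    induction g using TensorProduct.induction_on with
    | zero => rw [TensorProduct.tmul_zero]; exact zero
    | add x y hx hy => rw [TensorProduct.tmul_add]; exact add _ _ hx hy
    | tmul p w => exact tmul f p w

theorem SuperFun.tmul_mul_tmul (f g : SmoothFun U) (p q : MvPolynomial (Fin n) ℝ)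
    (v w : OddAlg n) :
    (f ⊗ₜ[ℝ] (p ⊗ₜ[ℝ] v) : SuperFun U) * g ⊗ₜ[ℝ] (q ⊗ₜ[ℝ] w) =
      (f * g) ⊗ₜ[ℝ] ((p * q) ⊗ₜ[ℝ] (v * w)) := by
  rw [Algebra.TensorProduct.tmul_mul_tmul, Algebra.TensorProduct.tmul_mul_tmul]

/-- The grading involution: it fixes `x` and `z` and changes the signs of `a` and `y`. -/
def parity (U : Opens (Coords n)) : SuperFun U →ₐ[ℝ] SuperFun U :=
  Algebra.TensorProduct.map (AlgHom.id ℝ _)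
    (Algebra.TensorProduct.map (AlgHom.id ℝ _) CliffordAlgebra.involute)

theorem parity_tmul (f : SmoothFun U) (p : MvPolynomial (Fin n) ℝ) (w : OddAlg n) :
    parity U (f ⊗ₜ[ℝ] (p ⊗ₜ[ℝ] w)) = f ⊗ₜ[ℝ] (p ⊗ₜ[ℝ] CliffordAlgebra.involute w) := rfl

theorem parity_iterate_tmul (k : ℕ) (f : SmoothFun U) (p : MvPolynomial (Fin n) ℝ)
    (w : OddAlg n) :
    (parity U)^[k] (f ⊗ₜ[ℝ] (p ⊗ₜ[ℝ] w)) =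
      f ⊗ₜ[ℝ] (p ⊗ₜ[ℝ] (CliffordAlgebra.involute)^[k] w) := by
  induction k generalizing w with
  | zero => rfl
  | succ k ih => rw [Function.iterate_succ_apply, parity_tmul, ih]; rfl

@[simp]
theorem parity_parity (F : SuperFun U) : parity U (parity U F) = F := by
  induction F using SuperFun.induction with
  | zero => simp
  | add F G hF hG => rw [map_add, map_add, hF, hG]
  | tmul f p w => rw [parity_tmul, parity_tmul, CliffordAlgebra.involute_involute]

theorem dx_tmul (i : Fin n) (f : SmoothFun U) (p : MvPolynomial (Fin n) ℝ) (w : OddAlg n) :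
    dx U i (f ⊗ₜ[ℝ] (p ⊗ₜ[ℝ] w)) = SmoothFun.pd i f ⊗ₜ[ℝ] (p ⊗ₜ[ℝ] w) := rfl

theorem dz_tmul (i : Fin n) (f : SmoothFun U) (p : MvPolynomial (Fin n) ℝ) (w : OddAlg n) :
    dz U i (f ⊗ₜ[ℝ] (p ⊗ₜ[ℝ] w)) = f ⊗ₜ[ℝ] (MvPolynomial.pderiv i p ⊗ₜ[ℝ] w) := rfl

theorem dodd_tmul (s : Fin n ⊕ Fin n) (f : SmoothFun U) (p : MvPolynomial (Fin n) ℝ)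
    (w : OddAlg n) :
    dodd U s (f ⊗ₜ[ℝ] (p ⊗ₜ[ℝ] w)) = f ⊗ₜ[ℝ] (p ⊗ₜ[ℝ]
      (CliffordAlgebra.contractLeft (LinearMap.proj s : Module.Dual ℝ (Fin n ⊕ Fin n → ℝ)) w)) :=
  rfl

theorem dx_mul (i : Fin n) (F G : SuperFun U) :
    dx U i (F * G) = dx U i F * G + F * dx U i G := by
  induction F using SuperFun.induction with
  | zero => simp
  | add F F' h h' => simp only [add_mul, map_add, h, h']; abel
  | tmul f p w =>
    induction G using SuperFun.induction with
    | zero => simp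
    | add F F' h h' => simp only [mul_add, map_add, h, h']; abel
    | tmul g q v =>
      simp only [SuperFun.tmul_mul_tmul, dx_tmul, Derivation.leibniz, ← TensorProduct.add_tmul,
        smul_eq_mul]
      rw [add_comm, mul_comm g]

theorem dz_mul (i : Fin n) (F G : SuperFun U) :
    dz U i (F * G) = dz U i F * G + F * dz U i G := by
  induction F using SuperFun.induction with
  | zero => simp
  | add F F' h h' => simp only [add_mul, map_add, h, h']; abel
  | tmul f p w =>
    induction G using SuperFun.induction with
    | zero => simp
    | add F F' h h' => simp only [mul_add, map_add, h, h']; abel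
    | tmul g q v =>
      simp only [SuperFun.tmul_mul_tmul, dz_tmul, Derivation.leibniz, ← TensorProduct.add_tmul,
        ← TensorProduct.tmul_add, smul_eq_mul]
      rw [add_comm, mul_comm q]

theorem dodd_mul (s : Fin n ⊕ Fin n) (F G : SuperFun U) :
    dodd U s (F * G) = dodd U s F * G + parity U F * dodd U s G := by
  induction F using SuperFun.induction with
  | zero => simp
  | add F F' h h' => simp only [add_mul, map_add, h, h']; abel
  | tmul f p w =>
    induction G using SuperFun.induction with
    | zero => simp
    | add F F' h h' => simp only [mul_add, map_add, h, h']; abel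
    | tmul g q v =>
      simp only [SuperFun.tmul_mul_tmul, dodd_tmul, parity_tmul, ExteriorAlgebra.contractLeft_mul,
        ← TensorProduct.tmul_add]

theorem parity_dx (i : Fin n) (F : SuperFun U) :
    parity U (dx U i F) = dx U i (parity U F) := by
  induction F using SuperFun.induction with
  | zero => simp
  | add F G hF hG => simp only [map_add, hF, hG]
  | tmul f p w => rfl

theorem parity_dz (i : Fin n) (F : SuperFun U) :
    parity U (dz U i F) = dz U i (parity U F) := by
  induction F using SuperFun.induction with
  | zero => simp
  | add F G hF hG => simp only [map_add, hF, hG]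
  | tmul f p w => rfl

theorem parity_dodd (s : Fin n ⊕ Fin n) (F : SuperFun U) :
    parity U (dodd U s F) = -dodd U s (parity U F) := by
  induction F using SuperFun.induction with
  | zero => simp
  | add F G hF hG => simp only [map_add, hF, hG]; abel
  | tmul f p w =>
    simp only [dodd_tmul, parity_tmul, ExteriorAlgebra.involute_contractLeft,
      TensorProduct.tmul_neg]

/-! ### Degrees -/

/-- No scalar multiplication case is needed: a real factor is absorbed into the smooth coefficient
`f`. -/
theorem degreePart_induction {k : ℕ} {motive : SuperFun U → Prop} {F : SuperFun U}
    (hF : F ∈ degreePart U k) (zero : motive 0)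
    (tmul : ∀ (m r : ℕ), 2 * m + r = k → ∀ (f : SmoothFun U),
      ∀ p ∈ MvPolynomial.homogeneousSubmodule (Fin n) ℝ m,
      ∀ w ∈ ⋀[ℝ]^r (Fin n ⊕ Fin n → ℝ), motive (f ⊗ₜ[ℝ] (p ⊗ₜ[ℝ] (w : OddAlg n))))
    (add : ∀ F G, motive F → motive G → motive (F + G)) : motive F := by
  have hs : ∀ (c : ℝ) (m r : ℕ), 2 * m + r = k → ∀ (f : SmoothFun U),
      ∀ p ∈ MvPolynomial.homogeneousSubmodule (Fin n) ℝ m,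
      ∀ w ∈ ⋀[ℝ]^r (Fin n ⊕ Fin n → ℝ), motive (c • f ⊗ₜ[ℝ] (p ⊗ₜ[ℝ] (w : OddAlg n))) := by
    intro c m r hk f p hp w hw
    rw [TensorProduct.smul_tmul']
    exact tmul m r hk _ p hp w hw
  rw [degreePart, Submodule.mem_span_iff_exists_finset_subset] at hF
  obtain ⟨c, t, ht, -, rfl⟩ := hF
  refine Finset.sum_induction _ motive add zero fun G hG => ?_
  obtain ⟨m, r, hk, f, p, hp, w, hw, e⟩ := ht hG
  generalize c G = d
  subst e
  exact hs d m r hk f p hp w hw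

theorem mul_mem_degreePart {k l : ℕ} {F G : SuperFun U} (hF : F ∈ degreePart U k)
    (hG : G ∈ degreePart U l) : F * G ∈ degreePart U (k + l) := by
  refine degreePart_induction (motive := fun F => F * G ∈ degreePart U (k + l)) hF ?_ ?_ ?_
  · rw [zero_mul]; exact zero_mem _
  · intro m r hk f p hp w hw
    refine degreePart_induction
      (motive := fun G => f ⊗ₜ[ℝ] (p ⊗ₜ[ℝ] w) * G ∈ degreePart U (k + l)) hG ?_ ?_ ?_
    · rw [mul_zero]; exact zero_mem _
    · intro m' r' hl g q hq v hv
      rw [SuperFun.tmul_mul_tmul]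
      refine Submodule.subset_span ⟨m + m', r + r', by omega, f * g, p * q, ?_, w * v, ?_, rfl⟩
      · exact MvPolynomial.IsHomogeneous.mul hp hq
      · have := Submodule.mul_mem_mul hw hv
        rwa [← pow_add] at this
    · intro F F' h h'
      rw [mul_add]; exact add_mem h h'
  · intro F F' h h'
    rw [add_mul]; exact add_mem h h'

theorem ι_mem_exteriorPower_one (v : Fin n ⊕ Fin n → ℝ) :
    ExteriorAlgebra.ι ℝ v ∈ ⋀[ℝ]^1 (Fin n ⊕ Fin n → ℝ) := by
  change _ ∈ LinearMap.range (ExteriorAlgebra.ι ℝ) ^ 1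
  rw [pow_one]
  exact LinearMap.mem_range_self _ _

theorem base_mem_degreePart (f : SmoothFun U) : base f ∈ degreePart U 0 :=
  Submodule.subset_span ⟨0, 0, rfl, f, 1, MvPolynomial.isHomogeneous_one _ _, 1,
    Submodule.one_le.mp le_rfl, rfl⟩

theorem a_mem_degreePart (i : Fin n) : a U i ∈ degreePart U 1 :=
  Submodule.subset_span ⟨0, 1, rfl, 1, 1, MvPolynomial.isHomogeneous_one _ _, _,
    ι_mem_exteriorPower_one _, rfl⟩

theorem y_mem_degreePart (i : Fin n) : y U i ∈ degreePart U 1 :=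
  Submodule.subset_span ⟨0, 1, rfl, 1, 1, MvPolynomial.isHomogeneous_one _ _, _,
    ι_mem_exteriorPower_one _, rfl⟩

theorem z_mem_degreePart (i : Fin n) : z U i ∈ degreePart U 2 :=
  Submodule.subset_span ⟨1, 0, rfl, 1, _, MvPolynomial.isHomogeneous_X _ _, 1,
    Submodule.one_le.mp le_rfl, rfl⟩

theorem parity_of_mem_degreePart {k : ℕ} {F : SuperFun U} (hF : F ∈ degreePart U k) :
    parity U F = (-1 : ℝ) ^ k • F := by
  refine degreePart_induction (motive := fun F => parity U F = (-1 : ℝ) ^ k • F) hF ?_ ?_ ?_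
  · simp
  · intro m r hk f p hp w hw
    rw [parity_tmul, ExteriorAlgebra.involute_of_mem hw, ← hk, pow_add, pow_mul]
    simp [TensorProduct.tmul_smul]
  · intro F F' h h'
    rw [map_add, h, h', smul_add]

theorem mul_comm_of_mem_degreePart {k : ℕ} {F : SuperFun U} (hF : F ∈ degreePart U k)
    (G : SuperFun U) : F * G = (parity U)^[k] G * F := by
  refine degreePart_induction (motive := fun F => F * G = (parity U)^[k] G * F) hF ?_ ?_ ?_
  · simp
  · intro m r hk f p hp w hw
    -- Only the r odd factors produce signs; the degree k exceeds r by the even number 2m, and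
    -- `parity` is an involution.
    have e : (parity U)^[k] = (parity U)^[r] := by
      rw [← hk, Function.iterate_add, Function.iterate_mul]
      have : (parity U)^[2] = id := funext fun F => parity_parity F
      rw [this, Function.iterate_id, Function.id_comp]
    rw [e]
    induction G using SuperFun.induction with
    | zero => simp [iterate_map_zero]
    | add F F' h h' => rw [mul_add, h, h', iterate_map_add, add_mul]
    | tmul g q v =>
      rw [parity_iterate_tmul, SuperFun.tmul_mul_tmul, SuperFun.tmul_mul_tmul,
        ExteriorAlgebra.mul_eq_involute_iterate_mul hw, mul_comm f, mul_comm p]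
  · intro F F' h h'
    rw [add_mul, h, h', mul_add]


/-! ### Linear, quadratic and cubic expressions with coefficients in a central subalgebra -/

section Multilinear

variable {ι 𝒪 𝒜 : Type*} [Fintype ι] [CommRing 𝒪] [Algebra ℝ 𝒪] [Ring 𝒜] [Algebra ℝ 𝒜]

/-- The expression `∑ T j v j`. -/
def lin (b : 𝒪 →ₐ[ℝ] 𝒜) (T : ι → 𝒪) (v : ι → 𝒜) : 𝒜 := ∑ j, b (T j) * v j

/-- The expression `∑ T j k v j w k`. -/
def quad (b : 𝒪 →ₐ[ℝ] 𝒜) (T : ι → ι → 𝒪) (v w : ι → 𝒜) : 𝒜 :=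
  ∑ j, ∑ k, b (T j k) * v j * w k

/-- The expression `∑ T j k l u j v k w l`. -/
def cub (b : 𝒪 →ₐ[ℝ] 𝒜) (T : ι → ι → ι → 𝒪) (u v w : ι → 𝒜) : 𝒜 :=
  ∑ j, ∑ k, ∑ l, b (T j k l) * u j * v k * w l

/-- Elementwise anticommutation of two families. -/
def AntiComm (v w : ι → 𝒜) : Prop := ∀ j k, v j * w k = -(w k * v j)

variable {b : 𝒪 →ₐ[ℝ] 𝒜} (T T' : ι → ι → 𝒪) (C C' : ι → ι → ι → 𝒪) (u u' v v' w w' : ι → 𝒜)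

omit [Fintype ι] [Algebra ℝ 𝒜] in
theorem AntiComm.symm {v w : ι → 𝒜} (h : AntiComm v w) : AntiComm w v := fun j k => by
  rw [h k j, neg_neg]

theorem quad_congr {T T' : ι → ι → 𝒪} (h : ∀ j k, T j k = T' j k) :
    quad b T v w = quad b T' v w := by
  rw [funext fun j => funext fun k => h j k]

theorem cub_congr {C C' : ι → ι → ι → 𝒪} (h : ∀ j k l, C j k l = C' j k l) :
    cub b C u v w = cub b C' u v w := by
  rw [funext fun j => funext fun k => funext fun l => h j k l]

theorem lin_sub_right (t : ι → 𝒪) :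
    lin b t (fun i => v i - w i) = lin b t v - lin b t w := by
  simp [lin, mul_sub, Finset.sum_sub_distrib]

theorem lin_add_right (t : ι → 𝒪) :
    lin b t (fun i => v i + w i) = lin b t v + lin b t w := by
  simp [lin, mul_add, Finset.sum_add_distrib]

theorem lin_smul_right (t : ι → 𝒪) (r : ℝ) :
    lin b t (fun i => r • v i) = r • lin b t v := by
  simp [lin, Finset.smul_sum]

theorem quad_add_coeff :
    quad b (fun j k => T j k + T' j k) v w = quad b T v w + quad b T' v w := by
  simp [quad, add_mul, Finset.sum_add_distrib]

theorem quad_sub_coeff :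
    quad b (fun j k => T j k - T' j k) v w = quad b T v w - quad b T' v w := by
  simp [quad, sub_mul, Finset.sum_sub_distrib]

theorem quad_neg_coeff : quad b (fun j k => -T j k) v w = -quad b T v w := by
  simp [quad]

theorem quad_add_left : quad b T (fun i => v i + v' i) w = quad b T v w + quad b T v' w := by
  simp [quad, mul_add, add_mul, Finset.sum_add_distrib]

theorem quad_sub_left : quad b T (fun i => v i - v' i) w = quad b T v w - quad b T v' w := by
  simp [quad, mul_sub, sub_mul, Finset.sum_sub_distrib]

theorem quad_smul_left (r : ℝ) : quad b T (fun i => r • v i) w = r • quad b T v w := by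
  simp [quad, Finset.smul_sum]

theorem quad_zero_left : quad b T (fun _ => 0) w = 0 := by
  simp [quad]

theorem quad_zero_right : quad b T v (fun _ => 0) = 0 := by
  simp [quad]

theorem quad_add_right : quad b T v (fun i => w i + w' i) = quad b T v w + quad b T v w' := by
  simp [quad, mul_add, Finset.sum_add_distrib]

theorem cub_add_coeff :
    cub b (fun j k l => C j k l + C' j k l) u v w = cub b C u v w + cub b C' u v w := by
  simp [cub, add_mul, Finset.sum_add_distrib]

theorem cub_sub_coeff :
    cub b (fun j k l => C j k l - C' j k l) u v w = cub b C u v w - cub b C' u v w := by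
  simp [cub, sub_mul, Finset.sum_sub_distrib]

theorem cub_neg_coeff : cub b (fun j k l => -C j k l) u v w = -cub b C u v w := by
  simp [cub]

theorem cub_add_left :
    cub b C (fun i => u i + u' i) v w = cub b C u v w + cub b C u' v w := by
  simp [cub, mul_add, add_mul, Finset.sum_add_distrib]

theorem cub_neg_left : cub b C (fun i => -u i) v w = -cub b C u v w := by
  simp [cub]

theorem cub_add_mid :
    cub b C u (fun i => v i + v' i) w = cub b C u v w + cub b C u v' w := by
  simp [cub, mul_add, add_mul, Finset.sum_add_distrib]

theorem cub_add_right :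
    cub b C u v (fun i => w i + w' i) = cub b C u v w + cub b C u v w' := by
  simp [cub, mul_add, Finset.sum_add_distrib]

variable {u v w}

theorem quad_anticomm (h : AntiComm v w) :
    quad b T v w = -quad b (fun j k => T k j) w v := by
  rw [quad, quad, Finset.sum_comm]
  simp only [mul_assoc, h _ _, mul_neg, Finset.sum_neg_distrib]

theorem quad_comm (h : ∀ j k, v j * w k = w k * v j) :
    quad b T v w = quad b (fun j k => T k j) w v := by
  rw [quad, quad, Finset.sum_comm]
  simp only [mul_assoc, h _ _]

theorem cub_swap_left (h : AntiComm u v) :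
    cub b C u v w = -cub b (fun j k l => C k j l) v u w := by
  rw [cub, cub, Finset.sum_comm]
  simp only [mul_assoc (b _), h _ _, mul_neg, neg_mul, Finset.sum_neg_distrib]

theorem cub_swap_right (h : AntiComm v w) :
    cub b C u v w = -cub b (fun j k l => C j l k) u w v := by
  rw [cub, cub, ← Finset.sum_neg_distrib]
  refine Finset.sum_congr rfl fun j _ => ?_
  rw [Finset.sum_comm]
  simp only [mul_assoc (b _ * _), h _ _, mul_neg, Finset.sum_neg_distrib]

/-- A cyclic rotation is two transpositions, so the signs cancel. -/
theorem cub_rotate (huv : AntiComm u v) (huw : AntiComm u w) :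
    cub b C u v w = cub b (fun j k l => C l j k) v w u := by
  rw [cub_swap_left C huv, cub_swap_right _ huw, neg_neg]

theorem cub_self_swap_left (h : AntiComm v v) :
    cub b (fun j k l => C k j l) v v w = -cub b C v v w := by
  rw [cub_swap_left C h, neg_neg]

theorem cub_self_rotate (h : AntiComm v v) :
    cub b (fun j k l => C l j k) v v v = cub b C v v v := (cub_rotate C h h).symm

variable (u v w)

theorem sum_reverse₃ {β : Type*} [AddCommMonoid β] (F : ι → ι → ι → β) :
    ∑ i, ∑ j, ∑ k, F i j k = ∑ k, ∑ j, ∑ i, F i j k := by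
  rw [Finset.sum_comm]
  simp_rw [Finset.sum_comm (s := Finset.univ) (t := Finset.univ) (f := fun i k => F i _ k)]
  rw [Finset.sum_comm]

/-- This and the following substitution rules contract coefficients when one expression is inserted
into a slot of another. Leftmost slots need no commutation; the other slots need the coefficients to
be central, which is the hypothesis `hb` below. -/
theorem lin_quad (t : ι → 𝒪) :
    lin b t (fun i => quad b (C i) v w) = quad b (fun j k => ∑ i, t i * C i j k) v w := by
  simp only [lin, quad, map_sum, map_mul, Finset.mul_sum, Finset.sum_mul, mul_assoc]
  rw [Finset.sum_comm]
  exact Finset.sum_congr rfl fun _ _ => Finset.sum_comm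

theorem quad_lin_left (P : ι → ι → 𝒪) :
    quad b T (fun i => lin b (P i) v) w = quad b (fun j k => ∑ i, T i k * P i j) v w := by
  simp only [lin, quad, map_sum, map_mul, Finset.mul_sum, Finset.sum_mul, mul_assoc]
  exact sum_reverse₃ _

theorem quad_quad_left :
    quad b T (fun i => quad b (C i) u v) w =
      cub b (fun j k l => ∑ i, T i l * C i j k) u v w := by
  simp only [cub, quad, map_sum, map_mul, Finset.mul_sum, Finset.sum_mul, mul_assoc]
  simp_rw [Finset.sum_comm (s := Finset.univ) (t := Finset.univ)
    (f := fun (l : ι) (j : ι) => ∑ k, b (T _ l) * (b (C _ j k) * (u j * (v k * w l))))]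
  rw [Finset.sum_comm]
  exact Finset.sum_congr rfl fun _ _ => sum_reverse₃ _

theorem cub_eq_sum_quad : cub b C u v w = ∑ l, quad b (fun j k => C j k l) u v * w l := by
  simp only [cub, quad, Finset.sum_mul]
  rw [sum_reverse₃]
  exact Finset.sum_congr rfl fun _ _ => Finset.sum_comm

theorem cub_lin_left (P : ι → ι → 𝒪) :
    cub b C (fun i => lin b (P i) u) v w = cub b (fun j k l => ∑ i, C i k l * P i j) u v w := by
  simp only [cub_eq_sum_quad, quad_lin_left]

variable (hb : ∀ f x, b f * x = x * b f)
include hb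

theorem quad_lin_right (P : ι → ι → 𝒪) :
    quad b T v (fun i => lin b (P i) w) = quad b (fun j k => ∑ i, T j i * P i k) v w := by
  simp only [lin, quad, map_sum, map_mul, Finset.mul_sum, Finset.sum_mul]
  refine Finset.sum_congr rfl fun _ _ => ?_
  rw [Finset.sum_comm]
  simp only [mul_assoc]
  simp only [← mul_assoc (v _), ← hb]
  simp only [mul_assoc]

theorem cub_lin_mid (P : ι → ι → 𝒪) :
    cub b C u (fun i => lin b (P i) v) w = cub b (fun j k l => ∑ i, C j i l * P i k) u v w := by
  simp only [cub_eq_sum_quad, quad_lin_right _ _ _ hb]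

theorem cub_lin_right (P : ι → ι → 𝒪) :
    cub b C u v (fun i => lin b (P i) w) = cub b (fun j k l => ∑ i, C j k i * P i l) u v w := by
  simp only [lin, cub, map_sum, map_mul, Finset.mul_sum, Finset.sum_mul]
  refine Finset.sum_congr rfl fun _ _ => Finset.sum_congr rfl fun _ _ => ?_
  rw [Finset.sum_comm]
  refine Finset.sum_congr rfl fun _ _ => Finset.sum_congr rfl fun _ _ => ?_
  rw [← mul_assoc, ← hb _ (_ * _ * _), hb _ (b (P _ _))]
  simp only [mul_assoc]

omit hb

theorem deriv_cub {D : 𝒜 →ₗ[ℝ] 𝒜} (hD : ∀ x y, D (x * y) = D x * y + x * D y)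
    {δ : 𝒪 → 𝒪} (hδ : ∀ f, D (b f) = b (δ f)) :
    D (cub b C u v w) = cub b (fun j k l => δ (C j k l)) u v w +
      cub b C (fun i => D (u i)) v w + cub b C u (fun i => D (v i)) w +
      cub b C u v (fun i => D (w i)) := by
  simp only [cub, map_sum, hD, hδ, add_mul, Finset.sum_add_distrib]

section OddDerivation

variable {Q : 𝒜 →ₗ[ℝ] 𝒜} {ε : 𝒜 →ₐ[ℝ] 𝒜} {d : ι → 𝒪 → 𝒪} {X : ι → 𝒜}
  (hQ : ∀ x y, Q (x * y) = Q x * y + ε x * Q y) (hε : ∀ f, ε (b f) = b f)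
  (hX : ∀ f, Q (b f) = lin b (fun l => d l f) X)
include hQ hε hX

theorem oddDeriv_lin (t : ι → 𝒪) :
    Q (lin b t v) = quad b (fun l j => d l (t j)) X v + lin b t (fun i => Q (v i)) := by
  simp only [quad, lin, map_sum, hQ, hε, hX, Finset.sum_add_distrib, Finset.sum_mul]
  rw [Finset.sum_comm]

/-- Differentiating the coefficient opens a new leftmost slot filled by `X`, so a quadratic
expression yields a cubic one. The minus sign comes from `Q` passing the odd `v`. -/
theorem oddDeriv_quad (hv : ∀ i, ε (v i) = -v i) :
    Q (quad b T v w) = cub b (fun l j k => d l (T j k)) X v w +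
      quad b T (fun i => Q (v i)) w - quad b T v (fun i => Q (w i)) := by
  simp only [quad, cub, lin, map_sum, hQ, hε, hX, hv, map_mul, add_mul, Finset.sum_add_distrib,
    Finset.sum_mul, mul_neg, neg_mul, Finset.sum_neg_distrib, sub_eq_add_neg]
  congr 2
  exact (Finset.sum_congr rfl fun _ _ => Finset.sum_comm).trans Finset.sum_comm

end OddDerivation

end Multilinear

variable {n : ℕ} {U : Opens (Coords n)}

/-! ### Commutation rules -/

theorem base_mul_comm (f : SmoothFun U) (F : SuperFun U) : base f * F = F * base f :=
  mul_comm_of_mem_degreePart (base_mem_degreePart f) F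

theorem mul_comm_of_mem_degreePart_two {F : SuperFun U} (hF : F ∈ degreePart U 2)
    (G : SuperFun U) : F * G = G * F := by
  have := mul_comm_of_mem_degreePart hF G
  simpa using this

theorem parity_of_mem_degreePart_one {F : SuperFun U} (hF : F ∈ degreePart U 1) :
    parity U F = -F := by
  simpa using parity_of_mem_degreePart hF

theorem parity_of_mem_degreePart_two {F : SuperFun U} (hF : F ∈ degreePart U 2) :
    parity U F = F := by
  simpa using parity_of_mem_degreePart hF

theorem parity_of_mem_degreePart_three {F : SuperFun U} (hF : F ∈ degreePart U 3) :
    parity U F = -F := by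
  have := parity_of_mem_degreePart hF
  norm_num at this
  exact this

theorem mul_comm_of_mem_degreePart_one {F : SuperFun U} (hF : F ∈ degreePart U 1)
    (G : SuperFun U) : F * G = parity U G * F :=
  mul_comm_of_mem_degreePart hF G

theorem mul_comm_of_mem_degreePart_three {F : SuperFun U} (hF : F ∈ degreePart U 3)
    (G : SuperFun U) : F * G = parity U G * F := by
  have := mul_comm_of_mem_degreePart hF G
  simpa using this

theorem antiComm_of_mem_degreePart_one {v w : Fin n → SuperFun U}
    (hv : ∀ i, v i ∈ degreePart U 1) (hw : ∀ i, w i ∈ degreePart U 1) : AntiComm v w :=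
  fun j k => by
    rw [mul_comm_of_mem_degreePart_one (hv j), parity_of_mem_degreePart_one (hw k), neg_mul]

theorem parity_base (f : SmoothFun U) : parity U (base f) = base f := by
  simpa using parity_of_mem_degreePart (base_mem_degreePart f)

/-! ### Derivatives of the coordinates -/

theorem base_eq (f : SmoothFun U) : (base f : SuperFun U) = f ⊗ₜ[ℝ] (1 ⊗ₜ[ℝ] 1) := rfl

theorem dx_base (i : Fin n) (f : SmoothFun U) : dx U i (base f) = base (SmoothFun.pd i f) := rfl

theorem dx_a (i j : Fin n) : dx U i (a U j) = 0 := by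
  rw [a, dx_tmul, Derivation.map_one_eq_zero, TensorProduct.zero_tmul]

theorem dx_y (i j : Fin n) : dx U i (y U j) = 0 := by
  rw [y, dx_tmul, Derivation.map_one_eq_zero, TensorProduct.zero_tmul]

theorem dx_z (i j : Fin n) : dx U i (z U j) = 0 := by
  rw [z, dx_tmul, Derivation.map_one_eq_zero, TensorProduct.zero_tmul]

theorem dz_base (i : Fin n) (f : SmoothFun U) : dz U i (base f) = 0 := by
  rw [base_eq, dz_tmul]; simp

theorem dz_a (i j : Fin n) : dz U i (a U j) = 0 := by
  rw [a, dz_tmul]; simp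

theorem dz_y (i j : Fin n) : dz U i (y U j) = 0 := by
  rw [y, dz_tmul]; simp

theorem dz_z (i j : Fin n) : dz U i (z U j) = if j = i then 1 else 0 := by
  rw [z, dz_tmul, MvPolynomial.pderiv_X, Pi.single_apply]
  split_ifs
  · rfl
  · simp

theorem dodd_base (s : Fin n ⊕ Fin n) (f : SmoothFun U) : dodd U s (base f) = 0 := by
  rw [base_eq, dodd_tmul, CliffordAlgebra.contractLeft_one]; simp

theorem dodd_z (s : Fin n ⊕ Fin n) (j : Fin n) : dodd U s (z U j) = 0 := by
  rw [z, dodd_tmul, CliffordAlgebra.contractLeft_one]; simp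

theorem dodd_ι_single (s t : Fin n ⊕ Fin n) :
    dodd U s ((1 : SmoothFun U) ⊗ₜ[ℝ] ((1 : MvPolynomial (Fin n) ℝ) ⊗ₜ[ℝ]
      ExteriorAlgebra.ι ℝ (Pi.single t (1 : ℝ)))) = if s = t then 1 else 0 := by
  rw [dodd_tmul]
  have := CliffordAlgebra.contractLeft_ι (0 : QuadraticForm ℝ (Fin n ⊕ Fin n → ℝ))
    (LinearMap.proj s) (Pi.single t (1 : ℝ))
  erw [this]
  rw [LinearMap.proj_apply, Pi.single_apply]
  split_ifs
  · rw [map_one]; rfl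
  · simp

theorem da_a (i j : Fin n) : da U i (a U j) = if i = j then 1 else 0 := by
  rw [da, a, dodd_ι_single]; simp

theorem da_y (i j : Fin n) : da U i (y U j) = 0 := by
  rw [da, y, dodd_ι_single]; simp

theorem dy_a (i j : Fin n) : dy U i (a U j) = 0 := by
  rw [dy, a, dodd_ι_single]; simp

theorem dy_y (i j : Fin n) : dy U i (y U j) = if i = j then 1 else 0 := by
  rw [dy, y, dodd_ι_single]; simp

/-! ### Vector fields of degree one -/

namespace SuperVectorField

variable (V : SuperVectorField U)

theorem act_apply (F : SuperFun U) : V.act F =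
    ∑ i, (V.X i * dx U i F + V.A i * da U i F + V.Y i * dy U i F + V.Z i * dz U i F) := by
  simp [act]

theorem act_base (f : SmoothFun U) : V.act (base f) = ∑ i, V.X i * base (SmoothFun.pd i f) := by
  simp [act_apply, dx_base, da, dy, dodd_base, dz_base]

theorem act_a (j : Fin n) : V.act (a U j) = V.A j := by
  simp [act_apply, dx_a, da_a, dy_a, dz_a]

theorem act_y (j : Fin n) : V.act (y U j) = V.Y j := by
  simp [act_apply, dx_y, da_y, dy_y, dz_y]

theorem act_z (j : Fin n) : V.act (z U j) = V.Z j := by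
  simp [act_apply, dx_z, da, dy, dodd_z, dz_z]

variable {V} (hV : V.HasDegreeOne)
include hV

/-- Even derivatives (x, z) carry components of odd degree 1 and 3, odd derivatives (a, y) carry
components of even degree 2. In each of the four terms the total sign on passing `F` is therefore
the same. -/
theorem act_mul (F G : SuperFun U) :
    V.act (F * G) = V.act F * G + parity U F * V.act G := by
  simp only [act_apply, Finset.sum_mul, Finset.mul_sum, ← Finset.sum_add_distrib]
  refine Finset.sum_congr rfl fun i _ => ?_
  have hX : V.X i * F = parity U F * V.X i := mul_comm_of_mem_degreePart_one (hV i).1 F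
  have hA : V.A i * parity U F = parity U F * V.A i :=
    mul_comm_of_mem_degreePart_two (hV i).2.1 _
  have hY : V.Y i * parity U F = parity U F * V.Y i :=
    mul_comm_of_mem_degreePart_two (hV i).2.2.1 _
  have hZ : V.Z i * F = parity U F * V.Z i := mul_comm_of_mem_degreePart_three (hV i).2.2.2 F
  simp only [dx_mul, dz_mul, da, dy, dodd_mul, mul_add, add_mul, ← mul_assoc, hX, hA, hY, hZ]
  abel

theorem parity_act (F : SuperFun U) : parity U (V.act F) = -V.act (parity U F) := by
  simp only [act_apply, map_sum, ← Finset.sum_neg_distrib]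
  refine Finset.sum_congr rfl fun i _ => ?_
  simp only [map_add, map_mul, parity_dx, parity_dz, da, dy, parity_dodd,
    parity_of_mem_degreePart_one (hV i).1, parity_of_mem_degreePart_two (hV i).2.1,
    parity_of_mem_degreePart_two (hV i).2.2.1, parity_of_mem_degreePart_three (hV i).2.2.2,
    neg_mul, mul_neg, neg_add]

/-- The two cross terms cancel because an odd operator anticommutes with the grading involution. -/
theorem act_act_mul (F G : SuperFun U) :
    V.act (V.act (F * G)) = V.act (V.act F) * G + F * V.act (V.act G) := by
  rw [act_mul hV, map_add, act_mul hV, act_mul hV, parity_act hV, parity_parity]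
  simp only [neg_mul]
  abel

end SuperVectorField


/-- Functions of x together with a, y, z generate the algebra, so a derivation vanishing on them is
zero. -/
theorem SuperFun.coordinate_induction {motive : SuperFun U → Prop} (F : SuperFun U)
    (base : ∀ f : SmoothFun U, motive (base f)) (a : ∀ i, motive (a U i))
    (y : ∀ i, motive (y U i)) (z : ∀ i, motive (z U i))
    (add : ∀ F G, motive F → motive G → motive (F + G))
    (mul : ∀ F G, motive F → motive G → motive (F * G)) : motive F := by
  have hconst : ∀ c : ℝ, motive (algebraMap ℝ (SuperFun U) c) := fun c => by
    have := base (algebraMap ℝ _ c)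
    rwa [AlgHom.commutes] at this
  have hpoly : ∀ p : MvPolynomial (Fin n) ℝ,
      motive ((1 : SmoothFun U) ⊗ₜ[ℝ] (p ⊗ₜ[ℝ] (1 : OddAlg n))) := fun p => by
    induction p using MvPolynomial.induction_on with
    | C c =>
      convert hconst c using 1
      rw [Algebra.algebraMap_eq_smul_one, Algebra.TensorProduct.one_def,
        Algebra.TensorProduct.one_def, ← TensorProduct.tmul_smul, TensorProduct.smul_tmul',
        ← MvPolynomial.C_mul', mul_one]
    | add p q hp hq =>
      rw [TensorProduct.add_tmul, TensorProduct.tmul_add]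
      exact add _ _ hp hq
    | mul_X p i hp =>
      have := mul _ _ hp (z i)
      rwa [BiTwisted.z, SuperFun.tmul_mul_tmul, mul_one, mul_one] at this
  have hι : ∀ v : Fin n ⊕ Fin n → ℝ, motive ((1 : SmoothFun U) ⊗ₜ[ℝ]
      ((1 : MvPolynomial (Fin n) ℝ) ⊗ₜ[ℝ] ExteriorAlgebra.ι ℝ v)) := fun v => by
    rw [← Finset.univ_sum_single v, map_sum, TensorProduct.tmul_sum, TensorProduct.tmul_sum]
    have h0 : motive 0 := by simpa using hconst 0
    refine Finset.sum_induction _ motive add h0 fun s _ => ?_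
    have hs : motive ((1 : SmoothFun U) ⊗ₜ[ℝ] ((1 : MvPolynomial (Fin n) ℝ) ⊗ₜ[ℝ]
        ExteriorAlgebra.ι ℝ (Pi.single s (1 : ℝ)))) := by
      rcases s with i | i
      · exact a i
      · exact y i
    have := mul _ _ (hconst (v s)) hs
    rwa [← Algebra.smul_def, ← TensorProduct.tmul_smul, ← TensorProduct.tmul_smul, ← map_smul,
      ← Pi.single_smul, smul_eq_mul, mul_one] at this
  have hodd : ∀ w : OddAlg n, motive ((1 : SmoothFun U) ⊗ₜ[ℝ]
      ((1 : MvPolynomial (Fin n) ℝ) ⊗ₜ[ℝ] w)) := fun w => by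
    induction w using ExteriorAlgebra.induction with
    | algebraMap c =>
      convert hconst c using 1
      rw [Algebra.algebraMap_eq_smul_one, Algebra.algebraMap_eq_smul_one,
        Algebra.TensorProduct.one_def, Algebra.TensorProduct.one_def, TensorProduct.tmul_smul,
        TensorProduct.tmul_smul]
    | ι v => exact hι v
    | add v w hv hw =>
      rw [TensorProduct.tmul_add, TensorProduct.tmul_add]
      exact add _ _ hv hw
    | mul v w hv hw =>
      have := mul _ _ hv hw
      rwa [SuperFun.tmul_mul_tmul, mul_one, mul_one] at this
  induction F using SuperFun.induction with
  | zero => simpa using hconst 0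
  | add F G hF hG => exact add F G hF hG
  | tmul f p w =>
    have := mul _ _ (mul _ _ (base f) (hpoly p)) (hodd w)
    simpa only [base_eq, SuperFun.tmul_mul_tmul, mul_one, one_mul] using this


/-! ### Completing the powers of w = y + Πa in the components of the vector field. -/

section Multilinear

variable {ι 𝒪 𝒜 : Type*} [Fintype ι] [CommRing 𝒪] [Algebra ℝ 𝒪] [Ring 𝒜] [Algebra ℝ 𝒜]
variable {b : 𝒪 →ₐ[ℝ] 𝒜} (hb : ∀ f x, b f * x = x * b f)
include hb

theorem AntiComm.lin_right {v w : ι → 𝒜} (h : AntiComm v w) (P : ι → ι → 𝒪) :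
    AntiComm v fun i => lin b (P i) w := fun j k => by
  simp only [lin, Finset.mul_sum, Finset.sum_mul, ← Finset.sum_neg_distrib]
  refine Finset.sum_congr rfl fun l _ => ?_
  rw [← mul_assoc, ← hb, mul_assoc, h j l, mul_assoc, mul_neg]

omit [Fintype ι] [Algebra ℝ 𝒜] hb in
theorem AntiComm.add_right {v w w' : ι → 𝒜} (h : AntiComm v w) (h' : AntiComm v w') :
    AntiComm v fun i => w i + w' i := fun j k => by
  rw [mul_add, add_mul, h j k, h' j k, neg_add]

variable {a y z : ι → 𝒜} (haa : AntiComm a a) (hay : AntiComm a y) (hyy : AntiComm y y)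
  {P : ι → ι → 𝒪} {R S : ι → ι → ι → 𝒪}
include haa hay

omit haa in
-- The two mixed terms coincide, since exchanging the slots gives one sign from `T` and one from the
-- odd variables.
theorem quad_add_lin_self (T : ι → ι → 𝒪) (hT : ∀ j k, T k j = -T j k) :
    quad b T (fun i => y i + lin b (P i) a) (fun i => y i + lin b (P i) a) = quad b T y y +
      (2 : ℝ) • quad b (fun j k => ∑ l, T j l * P l k) y a +
      quad b (fun j k => ∑ m, (∑ l, T l m * P l j) * P m k) a a := by
  rw [quad_add_left, quad_add_right, quad_add_right, quad_lin_right _ _ _ hb,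
    quad_lin_left, quad_lin_left, quad_lin_right _ _ _ hb, quad_anticomm _ hay,
    ← quad_neg_coeff, quad_congr (T := fun j k => -∑ l, T l j * P l k)
      (T' := fun j k => ∑ l, T j l * P l k)]
  · module
  · intro j k
    rw [← Finset.sum_neg_distrib]
    exact Finset.sum_congr rfl fun l _ => by rw [hT j l]; ring

omit haa in
theorem cub_add_lin_self (hS : ∀ i j k, S j i k = -S i j k) (hS' : ∀ i j k, S i k j = -S i j k) :
    cub b S (fun i => y i + lin b (P i) a) (fun i => y i + lin b (P i) a)
      (fun i => y i + lin b (P i) a) = cub b S y y y +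
      (3 : ℝ) • cub b (fun j k l => ∑ i, S j k i * P i l) y y a +
      (3 : ℝ) • cub b (fun j k l => ∑ i, (∑ m, S j m i * P m k) * P i l) y a a +
      cub b (fun j k l => ∑ i, (∑ m, (∑ p, S p m i * P p j) * P m k) * P i l) a a a := by
  have hyu : AntiComm y fun i => lin b (P i) a := hay.symm.lin_right hb P
  have hl : ∀ u v w : ι → 𝒜, AntiComm u v → cub b S u v w = cub b S v u w := fun u v w h => by
    rw [cub_swap_left _ h, ← cub_neg_coeff]
    exact cub_congr _ _ _ fun j k l => by rw [hS, neg_neg]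
  have hr : ∀ u v w : ι → 𝒜, AntiComm v w → cub b S u v w = cub b S u w v := fun u v w h => by
    rw [cub_swap_right _ h, ← cub_neg_coeff]
    exact cub_congr _ _ _ fun j k l => by rw [hS', neg_neg]
  set u : ι → 𝒜 := fun i => lin b (P i) a with hu
  have e1 : cub b S u y y = cub b S y y u := by rw [hl _ _ _ hyu.symm, hr _ _ _ hyu.symm]
  have e2 : cub b S y u y = cub b S y y u := hr _ _ _ hyu.symm
  have e3 : cub b S u y u = cub b S y u u := hl _ _ _ hyu.symm
  have e4 : cub b S u u y = cub b S y u u := by rw [hr _ _ _ hyu.symm, e3]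
  have f1 : cub b S y y u = cub b (fun j k l => ∑ i, S j k i * P i l) y y a :=
    cub_lin_right _ _ _ _ hb _
  have f2 : cub b S y u u =
      cub b (fun j k l => ∑ i, (∑ m, S j m i * P m k) * P i l) y a a := by
    rw [hu, cub_lin_mid _ _ _ _ hb, cub_lin_right _ _ _ _ hb]
  have f3 : cub b S u u u =
      cub b (fun j k l => ∑ i, (∑ m, (∑ p, S p m i * P p j) * P m k) * P i l) a a a := by
    rw [hu, cub_lin_left, cub_lin_mid _ _ _ _ hb, cub_lin_right _ _ _ _ hb]
  change cub b S (fun i => y i + u i) (fun i => y i + u i) (fun i => y i + u i) = _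
  simp only [cub_add_left, cub_add_mid, cub_add_right, e1, e2, e3, e4, f1, f2, f3]
  module

variable (hP : ∀ i j, P j i = -P i j)
  (hS : ∀ i j k, S j i k = -S i j k) (hS' : ∀ i j k, S i k j = -S i j k)
include hP hS hS'

omit haa in
-- The terms in ΠΘ, Θ and S are the aa, ya and yy parts of ½ S(w, w).
theorem component_a_normalForm (D : ι → ι → ι → 𝒪) (i : ι) :
    (-∑ j, ∑ k, (1 / 2 : ℝ) • (b (D i j k) * a j * a k)) + z i
      + ∑ j, ∑ k, ∑ m, (1 / 2 : ℝ) • (b (P j m * ∑ l, P k l * S l m i) * a k * a j)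
      - ∑ j, ∑ k, b (∑ l, P k l * S l i j) * y j * a k
      + ∑ j, ∑ k, (1 / 2 : ℝ) • (b (S i j k) * y j * y k) =
    z i - (1 / 2 : ℝ) • quad b (D i) a a + (1 / 2 : ℝ) • quad b (S i)
      (fun i => y i + lin b (P i) a) (fun i => y i + lin b (P i) a) := by
  have h1 : ∑ j, ∑ k, ∑ m, b (P j m * ∑ l, P k l * S l m i) * a k * a j =
      quad b (fun j k => ∑ m, (∑ l, S i l m * P l j) * P m k) a a := by
    rw [quad, Finset.sum_comm]
    refine Finset.sum_congr rfl fun j _ => Finset.sum_congr rfl fun k _ => ?_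
    rw [← Finset.sum_mul, ← Finset.sum_mul, ← map_sum]
    congr 3
    refine Finset.sum_congr rfl fun m _ => ?_
    rw [Finset.mul_sum, Finset.sum_mul]
    refine Finset.sum_congr rfl fun l _ => ?_
    rw [hS' l i m, hS i l m, hP k m, hP j l]
    ring
  have h2 : ∑ j, ∑ k, b (∑ l, P k l * S l i j) * y j * a k =
      -quad b (fun j k => ∑ l, S i j l * P l k) y a := by
    rw [← quad_neg_coeff]
    refine quad_congr (T := fun j k => ∑ l, P k l * S l i j) _ _ fun j k => ?_
    rw [← Finset.sum_neg_distrib]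
    refine Finset.sum_congr rfl fun l _ => ?_
    rw [hS i l j, hS' i j l, hP k l]
    ring
  rw [quad_add_lin_self hb hay _ (hS' i)]
  simp only [← Finset.smul_sum, h1, h2]
  simp only [quad]
  module

omit haa hS in
-- The ya and yy parts of -½ Θ(w, w) are present on the left, but the aa part is not; adding it back
-- is what joins ⟨Π⊗Π⊗Π, S⟩ to `R`.
theorem component_y_normalForm (D : ι → ι → ι → 𝒪) (i : ι) :
    ∑ j, b (P j i) * z j - ∑ j, ∑ k, b (D j i k) * a k * y j
      + ∑ j, ∑ k, (1 / 2 : ℝ) • (b (R i j k) * a j * a k)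
      + ∑ j, ∑ k, ∑ m, b (P j m * ∑ l, P i l * S l m k) * a j * y k
      - ∑ j, ∑ k, (1 / 2 : ℝ) • (b (∑ l, P i l * S l j k) * y j * y k) =
    lin b (fun j => P j i) z - quad b (fun k j => D j i k) a y
      + (1 / 2 : ℝ) • quad b (fun j k => R i j k + ∑ l, ∑ m, ∑ r, P i l * P j m * P k r * S l m r)
        a a
      - (1 / 2 : ℝ) • quad b (fun j k => ∑ l, P i l * S l j k)
        (fun i => y i + lin b (P i) a) (fun i => y i + lin b (P i) a) := by
  have hT : ∀ j k, ∑ l, P i l * S l k j = -∑ l, P i l * S l j k := fun j k => by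
    simp only [hS' _ j k, mul_neg, Finset.sum_neg_distrib]
  have h1 : ∑ j, ∑ k, b (D j i k) * a k * y j =
      quad b (fun k j => D j i k) a y := Finset.sum_comm
  have h2 : ∑ j, ∑ k, ∑ m, b (P j m * ∑ l, P i l * S l m k) * a j * y k =
      -quad b (fun j k => ∑ m, (∑ l, P i l * S l j m) * P m k) y a := by
    rw [quad_anticomm _ hay.symm, neg_neg]
    refine Finset.sum_congr rfl fun j _ => Finset.sum_congr rfl fun k _ => ?_
    rw [← Finset.sum_mul, ← Finset.sum_mul, ← map_sum]
    congr 3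
    refine Finset.sum_congr rfl fun m _ => ?_
    rw [hP m j, hT k m]
    ring
  have h3 : quad b (fun j k => ∑ m, (∑ l, (∑ p, P i p * S p l m) * P l j) * P m k) a a =
      quad b (fun j k => ∑ l, ∑ m, ∑ r, P i l * P j m * P k r * S l m r) a a := by
    refine quad_congr _ _ fun j k => ?_
    simp only [Finset.sum_mul]
    rw [sum_reverse₃]
    refine Finset.sum_congr rfl fun _ _ => Finset.sum_congr rfl fun _ _ =>
      Finset.sum_congr rfl fun _ _ => ?_
    rw [hP j, hP k]
    ring
  rw [quad_add_lin_self hb hay _ hT, quad_add_coeff, h3]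
  simp only [← Finset.smul_sum, h1, h2]
  simp only [quad, lin]
  module

include hyy

omit haa hyy in
-- The left side is (1/6) S(w, w, w) without its aaa part. That part is -(1/6) ⟨Π⊗Π⊗Π, S⟩ contracted
-- with aaa, because each of the three factors Π is transposed; hence the added term.
theorem cub_add_lin_self_sub :
    (1 / 2 : ℝ) • cub b (fun l j k => ∑ m, P k m * ∑ p, P j p * S p m l) y a a
      - (1 / 2 : ℝ) • cub b (fun j m k => ∑ p, P k p * S p j m) y y a
      + (1 / 6 : ℝ) • cub b S y y y =
    (1 / 6 : ℝ) • cub b S (fun i => y i + lin b (P i) a) (fun i => y i + lin b (P i) a)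
      (fun i => y i + lin b (P i) a) +
    (1 / 6 : ℝ) • cub b (fun i j k => ∑ l, ∑ m, ∑ r, P i l * P j m * P k r * S l m r) a a a := by
  have h1 : cub b (fun l j k => ∑ m, P k m * ∑ p, P j p * S p m l) y a a =
      cub b (fun j k l => ∑ i, (∑ m, S j m i * P m k) * P i l) y a a := by
    refine cub_congr _ _ _ fun l j k => Finset.sum_congr rfl fun m _ => ?_
    rw [Finset.mul_sum, Finset.sum_mul]
    refine Finset.sum_congr rfl fun p _ => ?_
    rw [hS' p l m, hS l p m, hP k m, hP j p]
    ring
  have h2 : cub b (fun j m k => ∑ p, P k p * S p j m) y y a =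
      -cub b (fun j k l => ∑ i, S j k i * P i l) y y a := by
    rw [← cub_neg_coeff]
    refine cub_congr _ _ _ fun j m k => ?_
    rw [← Finset.sum_neg_distrib]
    refine Finset.sum_congr rfl fun p _ => ?_
    rw [hS j p m, hS' j m p, hP k p]
    ring
  have h3 : cub b (fun j k l => ∑ i, (∑ m, (∑ p, S p m i * P p j) * P m k) * P i l) a a a =
      -cub b (fun i j k => ∑ l, ∑ m, ∑ r, P i l * P j m * P k r * S l m r) a a a := by
    rw [← cub_neg_coeff]
    refine cub_congr _ _ _ fun i j k => ?_
    simp only [Finset.sum_mul, ← Finset.sum_neg_distrib]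
    rw [sum_reverse₃]
    refine Finset.sum_congr rfl fun l _ => Finset.sum_congr rfl fun m _ =>
      Finset.sum_congr rfl fun r _ => ?_
    rw [hP i, hP j, hP k]
    ring
  rw [cub_add_lin_self hb hay hS hS', h1, h2, h3]
  module

/-- The S-dependent terms of the z-component, apart from H, are the x-derivative of the preceding
identity, with a and y held constant. On the right, w still depends on x through Π, which produces
the term with ∂Π. -/
theorem component_z_normalForm {D : 𝒜 →ₗ[ℝ] 𝒜} (hD : ∀ x y, D (x * y) = D x * y + x * D y)
    {δ : Derivation ℝ 𝒪 𝒪} (hδ : ∀ f, D (b f) = b (δ f)) (hDa : ∀ i, D (a i) = 0)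
    (hDy : ∀ i, D (y i) = 0) :
    ∑ j, ∑ k, ∑ m, ∑ l, (1 / 2 : ℝ) • (b (δ (P k m * ∑ p, P j p * S p m l)) * y l * a j * a k)
      - ∑ j, ∑ k, ∑ m, (1 / 2 : ℝ) • (b (δ (∑ p, P k p * S p j m)) * y j * y m * a k)
      + ∑ j, ∑ k, ∑ l, (1 / 6 : ℝ) • (b (δ (S j k l)) * y j * y k * y l) =
    (1 / 6 : ℝ) • cub b (fun j k l => δ (S j k l)) (fun i => y i + lin b (P i) a)
      (fun i => y i + lin b (P i) a) (fun i => y i + lin b (P i) a) +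
    (1 / 2 : ℝ) • cub b (fun j k l => ∑ i, S i k l * δ (P i j)) a (fun i => y i + lin b (P i) a)
      (fun i => y i + lin b (P i) a) +
    (1 / 6 : ℝ) • cub b (fun i j k =>
      δ (∑ l, ∑ m, ∑ r, P i l * P j m * P k r * S l m r)) a a a := by
  have h := congrArg D (cub_add_lin_self_sub hb hay hP hS hS')
  have h1 : ∑ j, ∑ k, ∑ m, ∑ l, b (δ (P k m * ∑ p, P j p * S p m l)) * y l * a j * a k =
      cub b (fun l j k => δ (∑ m, P k m * ∑ p, P j p * S p m l)) y a a := by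
    refine (Finset.sum_congr rfl fun j _ => (Finset.sum_congr rfl fun k _ =>
      Finset.sum_comm).trans Finset.sum_comm).trans (Finset.sum_comm.trans ?_)
    simp only [cub, map_sum, Finset.sum_mul]
  have h2 : ∑ j, ∑ k, ∑ m, b (δ (∑ p, P k p * S p j m)) * y j * y m * a k =
      cub b (fun j m k => δ (∑ p, P k p * S p j m)) y y a :=
    Finset.sum_congr rfl fun _ _ => Finset.sum_comm
  simp only [← Finset.smul_sum, h1, h2]
  set w : ι → 𝒜 := fun i => y i + lin b (P i) a with hw
  have hDw : ∀ i, D (w i) = lin b (fun j => δ (P i j)) a := fun i => by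
    simp only [hw, map_add, hDy, lin, map_sum, hD, hδ, hDa]
    simp
  have hww : AntiComm w w := by
    have := hyy.add_right (hay.symm.lin_right hb P)
    have h' := (hay.add_right (haa.lin_right hb P)).symm.lin_right hb P
    exact (this.symm.add_right h').symm
  have haw : AntiComm a w := hay.add_right (haa.lin_right hb P)
  have hDwl : AntiComm (fun i => lin b (fun j => δ (P i j)) a) w :=
    (haw.symm.lin_right hb fun i j => δ (P i j)).symm
  have z0 : ∀ (C : ι → ι → ι → 𝒪) (u v : ι → 𝒜), cub b C u v (fun _ => 0) = 0 :=
    fun _ _ _ => by simp [cub]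
  have z1 : ∀ (C : ι → ι → ι → 𝒪) (u v : ι → 𝒜), cub b C u (fun _ => 0) v = 0 :=
    fun _ _ _ => by simp [cub]
  have z2 : ∀ (C : ι → ι → ι → 𝒪) (u v : ι → 𝒜), cub b C (fun _ => 0) u v = 0 :=
    fun _ _ _ => by simp [cub]
  simp only [map_add, map_sub, map_smul, deriv_cub _ _ _ _ hD hδ, hDa, hDy, z0, z1, z2, hDw,
    add_zero] at h
  -- The derivative may fall on any of the three factors w; the three results agree, turning 1/6
  -- into 1/2.
  have g1 : cub b S (fun i => lin b (fun j => δ (P i j)) a) w w =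
      cub b (fun j k l => ∑ i, S i k l * δ (P i j)) a w w := cub_lin_left _ _ _ _ _
  have g2 : cub b S w (fun i => lin b (fun j => δ (P i j)) a) w =
      cub b S (fun i => lin b (fun j => δ (P i j)) a) w w := by
    rw [cub_swap_left _ hDwl.symm, ← cub_neg_coeff]
    exact cub_congr _ _ _ fun j k l => by rw [hS, neg_neg]
  have g3 : cub b S w w (fun i => lin b (fun j => δ (P i j)) a) =
      cub b S w (fun i => lin b (fun j => δ (P i j)) a) w := by
    rw [cub_swap_right _ hDwl.symm, ← cub_neg_coeff]
    exact cub_congr _ _ _ fun j k l => by rw [hS', neg_neg]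
  rw [g3, g2, g1] at h
  refine (Eq.trans ?_ h).trans ?_
  · simp only [cub]
  · module

end Multilinear


/-! ### The square of the vector field on x and a. -/

section Multilinear

variable {ι 𝒪 𝒜 : Type*} [Fintype ι] [CommRing 𝒪] [Algebra ℝ 𝒪] [Ring 𝒜] [Algebra ℝ 𝒜]

theorem quad_self_eq_zero {b : 𝒪 →ₐ[ℝ] 𝒜} {T : ι → ι → 𝒪} (hT : ∀ j k, T k j = T j k)
    {v : ι → 𝒜} (h : AntiComm v v) : quad b T v v = 0 := by
  have e : quad b T v v = -quad b T v v := by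
    conv_lhs => rw [quad_anticomm _ h]
    rw [quad_congr v v hT]
  have h2 : (2 : ℝ) • quad b T v v = 0 := by
    rw [two_smul]
    nth_rewrite 1 [e]
    exact neg_add_cancel _
  simpa using h2

/-- The components `½ [Π, Π]ⁱʲᵏ` as a cyclic sum. -/
def jacobiator (d : ι → Derivation ℝ 𝒪 𝒪) (P : ι → ι → 𝒪) (i j k : ι) : 𝒪 :=
  ∑ l, (P i l * d l (P j k) + P j l * d l (P k i) + P k l * d l (P i j))

variable {b : 𝒪 →ₐ[ℝ] 𝒜} (hb : ∀ f x, b f * x = x * b f)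
  {d : ι → Derivation ℝ 𝒪 𝒪} {Q : 𝒜 →ₗ[ℝ] 𝒜} {ε : 𝒜 →ₐ[ℝ] 𝒜}
  {a y w z : ι → 𝒜} {P : ι → ι → 𝒪} {S RC : ι → ι → ι → 𝒪}
  (hQ : ∀ x y, Q (x * y) = Q x * y + ε x * Q y) (hε : ∀ f, ε (b f) = b f)
  (hX : ∀ f, Q (b f) = lin b (fun l => d l f) (fun l => -w l))
  (hQa : ∀ i, Q (a i) = z i - (1 / 2 : ℝ) • quad b (fun j k => d i (P j k)) a a +
    (1 / 2 : ℝ) • quad b (S i) w w)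
  (hw : ∀ i, w i = y i + lin b (P i) a) (haa : AntiComm a a)
  (hP : ∀ i j, P j i = -P i j)
include hQ hε hX hQa hw haa hP

/-- In Q(y + Πa) the z-terms cancel by antisymmetry of Π, the ww-terms cancel since ΠS = Θ, and the
ya-terms cancel against the derivative of Π along y. Only aa-terms survive, and against the
anticommuting a's they form the cyclic sum. -/
theorem oddDeriv_component_x (hay : AntiComm a y)
    (hQy : ∀ i, Q (y i) = lin b (fun j => P j i) z - quad b (fun k j => d j (P i k)) a y
      + (1 / 2 : ℝ) • quad b (RC i) a a
      - (1 / 2 : ℝ) • quad b (fun j k => ∑ l, P i l * S l j k) w w) (i : ι) :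
    Q (-w i) = (1 / 2 : ℝ) • quad b (fun j k => jacobiator d P i j k - RC i j k) a a := by
  have e1 : lin b (fun j => P j i) z = -lin b (P i) z := by
    simp only [hP i, lin, map_neg, neg_mul, Finset.sum_neg_distrib]
  have e2 : quad b (fun k j => d j (P i k)) a y = -quad b (fun j k => d j (P i k)) y a :=
    quad_anticomm _ hay
  have e3 : quad b (fun l j => d l (P i j)) (fun l => -w l) a =
      -(quad b (fun l j => d l (P i j)) y a +
        quad b (fun j k => ∑ l, d l (P i k) * P l j) a a) := by
    rw [← quad_lin_left, ← quad_add_left]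
    simp only [quad, hw, mul_neg, neg_mul, Finset.sum_neg_distrib]
  have e4 : quad b (jacobiator d P i) a a =
      quad b (fun j k => ∑ l, P i l * d l (P j k)) a a +
        (2 : ℝ) • quad b (fun j k => ∑ l, d l (P i k) * P l j) a a := by
    have h1 : quad b (fun j k => ∑ l, P j l * d l (P k i)) a a =
        quad b (fun j k => ∑ l, d l (P i k) * P l j) a a := by
      refine quad_congr _ _ fun j k => Finset.sum_congr rfl fun l _ => ?_
      rw [hP i k, hP j l, map_neg]
      ring
    have h2 : quad b (fun j k => ∑ l, P k l * d l (P i j)) a a =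
        quad b (fun j k => ∑ l, d l (P i k) * P l j) a a := by
      rw [quad_anticomm _ haa, ← quad_neg_coeff]
      refine quad_congr _ _ fun j k => ?_
      rw [← Finset.sum_neg_distrib]
      refine Finset.sum_congr rfl fun l _ => ?_
      rw [hP l j]
      ring
    unfold jacobiator
    simp only [Finset.sum_add_distrib]
    rw [quad_add_coeff, quad_add_coeff, h1, h2]
    module
  rw [map_neg, hw, map_add, hQy, oddDeriv_lin _ hQ hε hX]
  simp only [hQa]
  rw [lin_add_right, lin_sub_right, lin_smul_right, lin_smul_right, lin_quad, lin_quad, e1, e2, e3,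
    quad_sub_coeff, e4]
  module

/-- Here Qw = 0 is already available and `hQz` has the Jacobiator in place of R + ⟨Π⊗Π⊗Π, S⟩. The
az, yaa and aww terms cancel pairwise; the aaa terms cancel because ∂_i of the Jacobiator,
contracted with aaa, is the Leibniz expansion of Π∂Π. What remains is cubic in w. -/
theorem oddDeriv_component_a (hd : ∀ i j f, d i (d j f) = d j (d i f))
    (haw : AntiComm a w) (hww : AntiComm w w)
    (haz : ∀ j k, z j * a k = a k * z j)
    (hQaa : ∀ j k, Q (a j) * a k = a k * Q (a j)) (hεa : ∀ i, ε (a i) = -a i)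
    (hεw : ∀ i, ε (w i) = -w i) (hQw : ∀ i, Q (w i) = 0)
    {H : ι → ι → ι → ι → 𝒪}
    (hQz : ∀ i, Q (z i) = quad b (fun k j => d i (P j k)) a z
      - (1 / 2 : ℝ) • cub b (fun j k l => d i (d j (P k l))) y a a
      + (1 / 6 : ℝ) • cub b (fun j k l => d i (jacobiator d P j k l)) a a a
      + (1 / 6 : ℝ) • cub b (fun j k l => d i (S j k l)) w w w
      + (1 / 2 : ℝ) • cub b (fun j k l => ∑ m, S m k l * d i (P m j)) a w w
      + (1 / 6 : ℝ) • cub b (H i) w w w) (i : ι) :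
    Q (z i - (1 / 2 : ℝ) • quad b (fun j k => d i (P j k)) a a +
      (1 / 2 : ℝ) • quad b (S i) w w) =
    (1 / 6 : ℝ) • cub b (fun j k l => H i j k l + (d i (S j k l) - d j (S i k l) + d k (S i j l)
      - d l (S i j k))) w w w := by
  have e1 : quad b (fun j k => d i (P j k)) a (fun j => Q (a j)) =
      -quad b (fun j k => d i (P j k)) (fun j => Q (a j)) a := by
    rw [quad_comm (v := a) _ (fun j k => (hQaa k j).symm), ← quad_neg_coeff]
    exact quad_congr _ _ fun j k => by rw [hP j k, map_neg]
  have e2 : quad b (fun j k => d i (P j k)) (fun j => Q (a j)) a =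
      quad b (fun k j => d i (P j k)) a z
      - (1 / 2 : ℝ) • cub b (fun j k l => ∑ m, d i (P m l) * d m (P j k)) a a a
      + (1 / 2 : ℝ) • cub b (fun j k l => ∑ m, S m k l * d i (P m j)) a w w := by
    simp only [hQa]
    rw [quad_add_left, quad_sub_left, quad_smul_left, quad_smul_left, quad_quad_left,
      quad_quad_left, quad_comm (v := z) _ haz, cub_rotate (u := a) _ haw haw]
    congr 2
    exact cub_congr _ _ _ fun j k l => Finset.sum_congr rfl fun m _ => mul_comm _ _
  have e3 : cub b (fun l j k => d l (d i (P j k))) (fun l => -w l) a a =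
      -(cub b (fun j k l => d i (d j (P k l))) y a a +
        cub b (fun j k l => ∑ m, d i (d m (P k l)) * P m j) a a a) := by
    rw [← cub_lin_left, ← cub_add_left, cub_neg_left]
    simp only [hd _ i]
    rw [funext hw]
  have e4 : cub b (fun l j k => d l (S i j k)) (fun l => -w l) w w =
      -cub b (fun j k l => d j (S i k l)) w w w := cub_neg_left _ _ _ _
  -- The three cyclic terms contribute equally against aaa, whence the factor 3.
  have e5 : cub b (fun j k l => d i (jacobiator d P j k l)) a a a =
      -((3 : ℝ) • cub b (fun j k l => ∑ m, d i (P m l) * d m (P j k)) a a a +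
        (3 : ℝ) • cub b (fun j k l => ∑ m, d i (d m (P k l)) * P m j) a a a) := by
    have h0 : cub b (fun j k l => d i (∑ m, P j m * d m (P k l))) a a a =
        -(cub b (fun j k l => ∑ m, d i (P m l) * d m (P j k)) a a a +
        cub b (fun j k l => ∑ m, d i (d m (P k l)) * P m j) a a a) := by
      rw [← cub_self_rotate (fun j k l => ∑ m, d i (d m (P k l)) * P m j) haa,
        ← cub_self_rotate (fun j k l => d i (∑ m, P j m * d m (P k l))) haa,
        ← cub_add_coeff, ← cub_neg_coeff]
      refine cub_congr _ _ _ fun j k l => ?_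
      rw [map_sum, ← Finset.sum_add_distrib, ← Finset.sum_neg_distrib]
      refine Finset.sum_congr rfl fun m _ => ?_
      rw [Derivation.leibniz, hP m l, map_neg, smul_eq_mul, smul_eq_mul]
      ring
    have h1 : cub b (fun j k l => d i (∑ m, P k m * d m (P l j))) a a a =
        cub b (fun j k l => d i (∑ m, P j m * d m (P k l))) a a a :=
      (cub_self_rotate (fun j k l => d i (∑ m, P k m * d m (P l j))) haa).symm
    have h2 : cub b (fun j k l => d i (∑ m, P l m * d m (P j k))) a a a =
        cub b (fun j k l => d i (∑ m, P j m * d m (P k l))) a a a :=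
      cub_self_rotate (fun j k l => d i (∑ m, P j m * d m (P k l))) haa
    simp only [jacobiator, Finset.sum_add_distrib, map_add]
    rw [cub_add_coeff, cub_add_coeff, h1, h2, h0]
    module
  -- Contracted with www, the last three terms of dS are all equal to -∂_j S_{ikl}; the factor 3/6
  -- matches the ½ of ½ S(w, w).
  have e6 : cub b (fun j k l => d k (S i j l)) w w w = -cub b (fun j k l => d j (S i k l)) w w w :=
    cub_self_swap_left (fun j k l => d j (S i k l)) hww
  have e7 : cub b (fun j k l => d l (S i j k)) w w w = cub b (fun j k l => d j (S i k l)) w w w :=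
    cub_self_rotate (fun j k l => d j (S i k l)) hww
  rw [map_add, map_sub, map_smul, map_smul, hQz, oddDeriv_quad _ _ _ hQ hε hX hεa,
    oddDeriv_quad _ _ _ hQ hε hX hεw]
  simp only [hQw]
  rw [quad_zero_left, quad_zero_right, e1, e2, e3, e4, e5, cub_add_coeff, cub_sub_coeff,
    cub_add_coeff, cub_sub_coeff, e6, e7]
  module

end Multilinear


/-! ### Commuting partial derivatives and degrees of the multilinear expressions. -/

variable {n : ℕ} {U : Opens (Coords n)}

/-- Algebra homomorphisms whose instances come from ring structures. -/
abbrev CoeffHom (𝒪 𝒜 : Type*) [CommRing 𝒪] [Algebra ℝ 𝒪] [Ring 𝒜] [Algebra ℝ 𝒜] : Type _ :=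
  𝒪 →ₐ[ℝ] 𝒜

/-- The inclusion `base` of the functions of `x`. -/
def coeffHom (U : Opens (Coords n)) : CoeffHom (SmoothFun U) (SuperFun U) := base

theorem coeffHom_apply (f : SmoothFun U) : coeffHom U f = base f := rfl

theorem coeffHom_mul_comm (f : SmoothFun U) (F : SuperFun U) :
    coeffHom U f * F = F * coeffHom U f := base_mul_comm f F

/-- Derivations whose instances come from ring structures. -/
abbrev CoeffDerivation (𝒪 : Type*) [CommRing 𝒪] [Algebra ℝ 𝒪] : Type _ := Derivation ℝ 𝒪 𝒪

/-- The partial derivatives of the functions of `x`. -/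
def partialDeriv (U : Opens (Coords n)) (i : Fin n) : CoeffDerivation (SmoothFun U) :=
  SmoothFun.pd i

theorem SmoothFun.pd_apply (i : Fin n) (f : SmoothFun U) (u : U) :
    (SmoothFun.pd i f : U → ℝ) u = fderiv ℝ (SmoothFun.ext f) u (coordVec i) := rfl

theorem SmoothFun.pd_comm (i j : Fin n) (f : SmoothFun U) :
    SmoothFun.pd i (SmoothFun.pd j f) = SmoothFun.pd j (SmoothFun.pd i f) := by
  have h : ∀ (i j : Fin n) (u : U), (SmoothFun.pd i (SmoothFun.pd j f) : U → ℝ) u =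
      fderiv ℝ (fderiv ℝ (SmoothFun.ext f)) u (coordVec i) (coordVec j) := fun i j u => by
    have hd : DifferentiableAt ℝ (fderiv ℝ (SmoothFun.ext f)) u :=
      (((SmoothFun.contDiffOn_ext f).fderiv_of_isOpen (m := ∞) U.isOpen le_rfl).contDiffAt
        (U.isOpen.mem_nhds u.2)).differentiableAt (by simp)
    rw [SmoothFun.pd_apply, SmoothFun.fderiv_ext_congr _
      (fun v => fderiv ℝ (SmoothFun.ext f) v (coordVec j)) u fun v => rfl,
      fderiv_clm_apply hd (differentiableAt_const _)]
    simp
  ext u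
  rw [h, h]
  exact (((SmoothFun.contDiffOn_ext f).contDiffAt (U.isOpen.mem_nhds u.2)).isSymmSndFDerivAt
    (by rw [minSmoothness_of_isRCLikeNormedField]; exact WithTop.coe_le_coe.2 le_top)) _ _

/-- A vector field of degree one squares to zero on the functions of `x` if it does so on the
coordinates. -/
theorem SuperVectorField.act_act_base {V : SuperVectorField U} (hV : V.HasDegreeOne)
    (hX : ∀ i, V.act (V.X i) = 0) (f : SmoothFun U) : V.act (V.act (base f)) = 0 := by
  have e : V.act (V.act (base f)) = -quad (coeffHom U)
      (fun i j => SmoothFun.pd j (SmoothFun.pd i f)) V.X V.X := by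
    simp only [act_base, map_sum, act_mul hV, hX, zero_mul, zero_add,
      parity_of_mem_degreePart_one (hV _).1, Finset.mul_sum, quad, neg_mul,
      Finset.sum_neg_distrib]
    simp only [coeffHom_apply, base_mul_comm, mul_assoc]
  -- The Hessian is symmetric while the odd components X anticommute.
  rw [e, quad_self_eq_zero (fun i j => SmoothFun.pd_comm i j f)
    (antiComm_of_mem_degreePart_one (fun i => (hV i).1) fun i => (hV i).1), neg_zero]

theorem smul_mem_degreePart {k : ℕ} (c : ℝ) {F : SuperFun U} (hF : F ∈ degreePart U k) :
    c • F ∈ degreePart U k := Submodule.smul_mem _ c hF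

theorem add_mem_degreePart {k : ℕ} {F G : SuperFun U} (hF : F ∈ degreePart U k)
    (hG : G ∈ degreePart U k) : F + G ∈ degreePart U k := Submodule.add_mem _ hF hG

theorem sub_mem_degreePart {k : ℕ} {F G : SuperFun U} (hF : F ∈ degreePart U k)
    (hG : G ∈ degreePart U k) : F - G ∈ degreePart U k := Submodule.sub_mem _ hF hG

theorem lin_mem_degreePart {k : ℕ} (t : Fin n → SmoothFun U) {v : Fin n → SuperFun U}
    (hv : ∀ i, v i ∈ degreePart U k) : lin (coeffHom U) t v ∈ degreePart U k := by
  refine Submodule.sum_mem _ fun j _ => ?_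
  have := mul_mem_degreePart (base_mem_degreePart (t j)) (hv j)
  rwa [zero_add] at this

theorem quad_mem_degreePart {k l m : ℕ} (h : k + l = m) (T : Fin n → Fin n → SmoothFun U)
    {v w : Fin n → SuperFun U} (hv : ∀ i, v i ∈ degreePart U k) (hw : ∀ i, w i ∈ degreePart U l) :
    quad (coeffHom U) T v w ∈ degreePart U m := by
  subst h
  refine Submodule.sum_mem _ fun i _ => Submodule.sum_mem _ fun j _ => ?_
  have := mul_mem_degreePart (mul_mem_degreePart (base_mem_degreePart (T i j)) (hv i)) (hw j)
  rwa [zero_add] at this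

theorem cub_mem_degreePart {k l m r : ℕ} (h : k + l + m = r)
    (T : Fin n → Fin n → Fin n → SmoothFun U)
    {u v w : Fin n → SuperFun U} (hu : ∀ i, u i ∈ degreePart U k)
    (hv : ∀ i, v i ∈ degreePart U l) (hw : ∀ i, w i ∈ degreePart U m) :
    cub (coeffHom U) T u v w ∈ degreePart U r := by
  subst h
  refine Submodule.sum_mem _ fun i _ => Submodule.sum_mem _ fun j _ =>
    Submodule.sum_mem _ fun k _ => ?_
  have := mul_mem_degreePart (mul_mem_degreePart (mul_mem_degreePart
    (base_mem_degreePart (T i j k)) (hu i)) (hv j)) (hw k)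
  rwa [zero_add] at this

theorem antiComm_a_a : AntiComm (a U) (a U) :=
  antiComm_of_mem_degreePart_one a_mem_degreePart a_mem_degreePart

theorem antiComm_a_y : AntiComm (a U) (y U) :=
  antiComm_of_mem_degreePart_one a_mem_degreePart y_mem_degreePart

theorem antiComm_y_y : AntiComm (y U) (y U) :=
  antiComm_of_mem_degreePart_one y_mem_degreePart y_mem_degreePart

theorem SuperVectorField.hasDegreeOne_of_mem {V : SuperVectorField U}
    (hX : ∀ i, V.X i ∈ degreePart U 1) (hA : ∀ i, V.A i ∈ degreePart U 2)
    (hY : ∀ i, V.Y i ∈ degreePart U 2) (hZ : ∀ i, V.Z i ∈ degreePart U 3) : V.HasDegreeOne :=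
  fun i => ⟨hX i, hA i, hY i, hZ i⟩

/-! ### The components of Q₊ in normal form. -/

section NormalForm

variable {P : Fin n → Fin n → SmoothFun U} {R S : Fin n → Fin n → Fin n → SmoothFun U}
  {H : Fin n → Fin n → Fin n → Fin n → SmoothFun U}

theorem shiftedY_eq : shiftedY P = fun i => y U i + lin (coeffHom U) (P i) (a U) := rfl

theorem shiftedY_mem_degreePart (i : Fin n) : shiftedY P i ∈ degreePart U 1 :=
  add_mem (y_mem_degreePart i) (lin_mem_degreePart _ a_mem_degreePart)

theorem antiComm_shiftedY : AntiComm (shiftedY P) (shiftedY P) :=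
  antiComm_of_mem_degreePart_one shiftedY_mem_degreePart shiftedY_mem_degreePart

theorem antiComm_a_shiftedY : AntiComm (a U) (shiftedY P) :=
  antiComm_of_mem_degreePart_one a_mem_degreePart shiftedY_mem_degreePart

variable (hP : ∀ i j, P j i = -P i j)
include hP

theorem Qplus_X (i : Fin n) : (Qplus P R S H).X i = -shiftedY P i := by
  simp only [Qplus, undeformedQ, shiftedY, hP i, map_neg, neg_mul, Finset.sum_neg_distrib]
  abel

variable (hS : ∀ i j k, S j i k = -S i j k) (hS' : ∀ i j k, S i k j = -S i j k)
include hS hS'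

theorem Qplus_A (i : Fin n) : (Qplus P R S H).A i = z U i
    - (1 / 2 : ℝ) • quad (coeffHom U) (fun j k => SmoothFun.pd i (P j k)) (a U) (a U)
    + (1 / 2 : ℝ) • quad (coeffHom U) (S i) (shiftedY P) (shiftedY P) :=
  component_a_normalForm (𝒪 := SmoothFun U) (𝒜 := SuperFun U) (b := coeffHom U)
    (a := a U) (y := y U) (z := z U)
    (P := P) (S := S) coeffHom_mul_comm antiComm_a_y hP hS hS'
    (fun i j k => SmoothFun.pd i (P j k)) i

omit hS in
theorem Qplus_Y (i : Fin n) : (Qplus P R S H).Y i = lin (coeffHom U) (fun j => P j i) (z U)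
    - quad (coeffHom U) (fun k j => SmoothFun.pd j (P i k)) (a U) (y U)
    + (1 / 2 : ℝ) • quad (coeffHom U) (fun j k => R i j k + contraction P S i j k) (a U) (a U)
    - (1 / 2 : ℝ) • quad (coeffHom U) (torsion P S i) (shiftedY P) (shiftedY P) :=
  component_y_normalForm (𝒪 := SmoothFun U) (𝒜 := SuperFun U) (b := coeffHom U)
    (a := a U) (y := y U) (z := z U)
    (P := P) (S := S) (R := R) coeffHom_mul_comm antiComm_a_y hP hS'
    (fun j i k => SmoothFun.pd j (P i k)) i

theorem Qplus_Z (i : Fin n) : (Qplus P R S H).Z i =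
    quad (coeffHom U) (fun k j => SmoothFun.pd i (P j k)) (a U) (z U)
    - (1 / 2 : ℝ) • cub (coeffHom U) (fun j k l => SmoothFun.pd i (SmoothFun.pd j (P k l)))
      (y U) (a U) (a U)
    + (1 / 6 : ℝ) • cub (coeffHom U) (fun j k l => SmoothFun.pd i (R j k l + contraction P S j k l))
      (a U) (a U) (a U)
    + (1 / 6 : ℝ) • cub (coeffHom U) (fun j k l => SmoothFun.pd i (S j k l))
      (shiftedY P) (shiftedY P) (shiftedY P)
    + (1 / 2 : ℝ) • cub (coeffHom U) (fun j k l => ∑ m, S m k l * SmoothFun.pd i (P m j))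
      (a U) (shiftedY P) (shiftedY P)
    + (1 / 6 : ℝ) • cub (coeffHom U) (H i) (shiftedY P) (shiftedY P) (shiftedY P) := by
  have h := component_z_normalForm (𝒪 := SmoothFun U) (𝒜 := SuperFun U) (b := coeffHom U)
    (a := a U) (y := y U)
    (P := P) (S := S) (D := dx U i) (δ := SmoothFun.pd i) coeffHom_mul_comm antiComm_a_a
    antiComm_a_y antiComm_y_y
    hP hS hS' (dx_mul i) (dx_base i) (dx_a i) (dx_y i)
  have h1 : ∑ j, ∑ k, base (SmoothFun.pd i (P j k)) * a U k * z U j =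
      quad (coeffHom U) (fun k j => SmoothFun.pd i (P j k)) (a U) (z U) := Finset.sum_comm
  have h2 : cub (coeffHom U) (fun j k l => SmoothFun.pd i (R j k l + contraction P S j k l))
      (a U) (a U) (a U) =
      cub (coeffHom U) (fun j k l => SmoothFun.pd i (R j k l)) (a U) (a U) (a U) +
      cub (coeffHom U) (fun j k l => SmoothFun.pd i (contraction P S j k l)) (a U) (a U) (a U) := by
    rw [← cub_add_coeff]
    exact cub_congr _ _ _ fun j k l => map_add _ _ _
  have h3 : (Qplus P R S H).Z i = (∑ j, ∑ k, base (SmoothFun.pd i (P j k)) * a U k * z U j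
      - (1 / 2 : ℝ) • cub (coeffHom U) (fun j k l => SmoothFun.pd i (SmoothFun.pd j (P k l)))
      (y U) (a U) (a U) + (1 / 6 : ℝ) • cub (coeffHom U) (fun j k l => SmoothFun.pd i (R j k l))
      (a U) (a U) (a U)) + (∑ j, ∑ k, ∑ m, ∑ l, (1 / 2 : ℝ) •
        (base (SmoothFun.pd i (P k m * torsion P S j m l)) * y U l * a U j * a U k)
    - ∑ j, ∑ k, ∑ m, (1 / 2 : ℝ) •
        (base (SmoothFun.pd i (torsion P S k j m)) * y U j * y U m * a U k)
    + ∑ j, ∑ k, ∑ l, (1 / 6 : ℝ) • (base (SmoothFun.pd i (S j k l)) * y U j * y U k * y U l)) +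
    (1 / 6 : ℝ) • cub (coeffHom U) (H i) (shiftedY P) (shiftedY P) (shiftedY P) := by
    simp only [Qplus, undeformedQ, cub, Finset.smul_sum, coeffHom_apply]
    abel
  have h4 : (∑ j, ∑ k, ∑ m, ∑ l, (1 / 2 : ℝ) •
        (base (SmoothFun.pd i (P k m * torsion P S j m l)) * y U l * a U j * a U k)
    - ∑ j, ∑ k, ∑ m, (1 / 2 : ℝ) •
        (base (SmoothFun.pd i (torsion P S k j m)) * y U j * y U m * a U k)
    + ∑ j, ∑ k, ∑ l, (1 / 6 : ℝ) • (base (SmoothFun.pd i (S j k l)) * y U j * y U k * y U l)) =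
    (1 / 6 : ℝ) • cub (coeffHom U) (fun j k l => SmoothFun.pd i (S j k l))
      (shiftedY P) (shiftedY P) (shiftedY P)
    + (1 / 2 : ℝ) • cub (coeffHom U) (fun j k l => ∑ m, S m k l * SmoothFun.pd i (P m j))
      (a U) (shiftedY P) (shiftedY P)
    + (1 / 6 : ℝ) • cub (coeffHom U) (fun j k l => SmoothFun.pd i (contraction P S j k l))
      (a U) (a U) (a U) := h
  rw [h3, h4, h1, h2, smul_add]
  abel

theorem Qplus_hasDegreeOne : (Qplus P R S H).HasDegreeOne := by
  have hw := shiftedY_mem_degreePart (P := P)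
  have ha := a_mem_degreePart (U := U)
  have hy := y_mem_degreePart (U := U)
  have hz := z_mem_degreePart (U := U)
  have hl (t) : lin (coeffHom U) t (z U) ∈ degreePart U 2 := lin_mem_degreePart t hz
  have q {v w : Fin n → SuperFun U} (hv : ∀ i, v i ∈ degreePart U 1)
      (hw : ∀ i, w i ∈ degreePart U 1) (T) : quad (coeffHom U) T v w ∈ degreePart U 2 :=
    quad_mem_degreePart (k := 1) (l := 1) (m := 2) rfl T hv hw
  have q' (T) : quad (coeffHom U) T (a U) (z U) ∈ degreePart U 3 :=
    quad_mem_degreePart (k := 1) (l := 2) (m := 3) rfl T ha hz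
  have c {u v w : Fin n → SuperFun U} (hu : ∀ i, u i ∈ degreePart U 1)
      (hv : ∀ i, v i ∈ degreePart U 1) (hw : ∀ i, w i ∈ degreePart U 1) (T) :
      cub (coeffHom U) T u v w ∈ degreePart U 3 :=
    cub_mem_degreePart (k := 1) (l := 1) (m := 1) (r := 3) rfl T hu hv hw
  refine SuperVectorField.hasDegreeOne_of_mem (fun i => ?_) (fun i => ?_) (fun i => ?_)
    (fun i => ?_)
  · rw [Qplus_X hP]
    exact Submodule.neg_mem _ (hw i)
  · rw [Qplus_A hP hS hS']
    refine add_mem_degreePart (sub_mem_degreePart (hz i) ?_) ?_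
    · exact smul_mem_degreePart _ (q ha ha _)
    · exact smul_mem_degreePart _ (q hw hw _)
  · rw [Qplus_Y hP hS']
    refine sub_mem_degreePart (add_mem_degreePart (sub_mem_degreePart (hl _) (q ha hy _)) ?_) ?_
    · exact smul_mem_degreePart _ (q ha ha _)
    · exact smul_mem_degreePart _ (q hw hw _)
  · rw [Qplus_Z hP hS hS']
    refine add_mem_degreePart (add_mem_degreePart (add_mem_degreePart (add_mem_degreePart
      (sub_mem_degreePart (q' _) ?_) ?_) ?_) ?_) ?_
    · exact smul_mem_degreePart _ (c hy ha ha _)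
    · exact smul_mem_degreePart _ (c ha ha ha _)
    · exact smul_mem_degreePart _ (c hw hw hw _)
    · exact smul_mem_degreePart _ (c ha hw hw _)
    · exact smul_mem_degreePart _ (c hw hw hw _)
end NormalForm


/-! ### Recovering alternating coefficients by odd derivatives. -/

section Multilinear

variable {ι 𝒪 𝒜 : Type*} [Fintype ι] [CommRing 𝒪] [Algebra ℝ 𝒪] [Ring 𝒜] [Algebra ℝ 𝒜]
  {b : 𝒪 →ₐ[ℝ] 𝒜}

theorem jacobiator_swap (d : ι → Derivation ℝ 𝒪 𝒪) {P : ι → ι → 𝒪} (hP : ∀ i j, P j i = -P i j)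
    (i j k : ι) : jacobiator d P i k j = -jacobiator d P i j k := by
  simp only [jacobiator, ← Finset.sum_neg_distrib]
  refine Finset.sum_congr rfl fun l _ => ?_
  rw [hP j k, hP j i, hP k i, map_neg, map_neg, map_neg]
  ring

omit [Algebra ℝ 𝒪] in
theorem sum_contraction_swap (P : ι → ι → 𝒪) {S : ι → ι → ι → 𝒪}
    (hS : ∀ i j k, S i k j = -S i j k) (i j k : ι) :
    ∑ l, ∑ m, ∑ r, P i l * P k m * P j r * S l m r =
      -∑ l, ∑ m, ∑ r, P i l * P j m * P k r * S l m r := by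
  simp only [← Finset.sum_neg_distrib]
  refine Finset.sum_congr rfl fun l _ => ?_
  rw [Finset.sum_comm]
  refine Finset.sum_congr rfl fun m _ => Finset.sum_congr rfl fun r _ => ?_
  rw [hS l m r]
  ring

theorem deriv_lin_eq_zero {D : 𝒜 →ₗ[ℝ] 𝒜} (hD : ∀ x y, D (x * y) = D x * y + x * D y)
    (hb : ∀ f, D (b f) = 0) {v : ι → 𝒜} (hv : ∀ i, D (v i) = 0) (t : ι → 𝒪) :
    D (lin b t v) = 0 := by
  simp [lin, hD, hb, hv]

theorem deriv_quad_eq_zero {D : 𝒜 →ₗ[ℝ] 𝒜} (hD : ∀ x y, D (x * y) = D x * y + x * D y)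
    (hb : ∀ f, D (b f) = 0) {v w : ι → 𝒜} (hv : ∀ i, D (v i) = 0) (hw : ∀ i, D (w i) = 0)
    (T : ι → ι → 𝒪) : D (quad b T v w) = 0 := by
  simp [quad, hD, hb, hv, hw]

section Contraction

variable [DecidableEq ι] {D : 𝒜 →ₗ[ℝ] 𝒜} {ε : 𝒜 →ₐ[ℝ] 𝒜} {v : ι → 𝒜} {s : ι}
  (hD : ∀ x y, D (x * y) = D x * y + ε x * D y) (hε : ∀ f, ε (b f) = b f)
  (hb : ∀ f, D (b f) = 0) (hv : ∀ i, D (v i) = if s = i then 1 else 0)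
include hD hε hb hv

theorem oddDeriv_lin_coordinate (t : ι → 𝒪) : D (lin b t v) = b (t s) := by
  simp [lin, hD, hε, hb, hv]

theorem oddDeriv_quad_coordinate (hεv : ∀ i, ε (v i) = -v i) (T : ι → ι → 𝒪) :
    D (quad b T v v) = lin b (fun k => T s k - T k s) v := by
  simp [quad, lin, hD, hε, hb, hv, hεv, add_mul, Finset.sum_add_distrib, mul_ite, ite_mul,
    sub_eq_add_neg]

theorem oddDeriv_cub_coordinate (hεv : ∀ i, ε (v i) = -v i) (C : ι → ι → ι → 𝒪) :
    D (cub b C v v v) = quad b (fun k l => C s k l - C k s l + C k l s) v v := by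
  simp [quad, cub, hD, hε, hb, hv, hεv, add_mul, Finset.sum_add_distrib, mul_ite, ite_mul,
    sub_eq_add_neg]

/-- Two odd derivatives leave T_{ss'} - T_{s's} = 2 T_{ss'}. The `v i` need not be coordinates: it
is enough that the derivations are dual to them and kill the coefficients, so w with ∂/∂y qualifies.
-/
theorem eq_zero_of_quad_eq_zero (hb' : Function.Injective b) {D' : 𝒜 →ₗ[ℝ] 𝒜}
    {s' : ι} (hD' : ∀ x y, D' (x * y) = D' x * y + ε x * D' y)
    (hbD' : ∀ f, D' (b f) = 0) (hv' : ∀ i, D' (v i) = if s' = i then 1 else 0)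
    (hεv : ∀ i, ε (v i) = -v i) {T : ι → ι → 𝒪} (hT : ∀ j k, T k j = -T j k)
    (h : quad b T v v = 0) : T s s' = 0 := by
  have h1 := congrArg D' (congrArg D h)
  rw [oddDeriv_quad_coordinate hD hε hb hv hεv, oddDeriv_lin_coordinate hD' hε hbD' hv', map_zero,
    map_zero, ← map_zero b] at h1
  have h2 : (2 : ℝ) • T s s' = 0 := by
    have := hb' h1
    rw [hT s s', sub_neg_eq_add] at this
    rw [two_smul, this]
  simpa using h2

theorem eq_zero_of_cub_eq_zero (hb' : Function.Injective b) {D' D'' : 𝒜 →ₗ[ℝ] 𝒜}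
    {s' s'' : ι} (hD' : ∀ x y, D' (x * y) = D' x * y + ε x * D' y)
    (hbD' : ∀ f, D' (b f) = 0) (hv' : ∀ i, D' (v i) = if s' = i then 1 else 0)
    (hD'' : ∀ x y, D'' (x * y) = D'' x * y + ε x * D'' y)
    (hbD'' : ∀ f, D'' (b f) = 0) (hv'' : ∀ i, D'' (v i) = if s'' = i then 1 else 0)
    (hεv : ∀ i, ε (v i) = -v i) {C : ι → ι → ι → 𝒪} (hC : ∀ i j k, C j i k = -C i j k)
    (hC' : ∀ i j k, C i k j = -C i j k) (h : cub b C v v v = 0) : C s s' s'' = 0 := by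
  have h1 := congrArg D h
  rw [oddDeriv_cub_coordinate hD hε hb hv hεv, map_zero] at h1
  -- After one derivative the coefficient is three times C_{sjk}, still alternating in j, k.
  have h2 := eq_zero_of_quad_eq_zero hD' hε hbD' hv' hb' hD'' hbD'' hv'' hεv (fun j k => by
    rw [hC' s j k, hC' k j s, hC j k s, hC' j k s]
    ring) h1
  have h3 : (3 : ℝ) • C s s' s'' = 0 := by
    rw [hC s s' s'', hC' s' s s'', hC s s' s''] at h2
    calc (3 : ℝ) • C s s' s'' = C s s' s'' - -C s s' s'' + - -C s s' s'' := by module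
      _ = 0 := h2
  simpa using h3

end Contraction

end Multilinear

/-- Setting a, y, z to 0 retracts the fibre algebra onto ℝ, and tensoring over a field preserves the
injection of constants. -/
theorem base_injective {n : ℕ} {U : Opens (Coords n)} :
    Function.Injective (base : SmoothFun U → SuperFun U) := by
  have hι : Function.Injective (algebraMap ℝ (FibreAlg n)) := by
    let φ : FibreAlg n →ₐ[ℝ] ℝ := Algebra.TensorProduct.lift (MvPolynomial.aeval fun _ => 0)
      ExteriorAlgebra.algebraMapInv fun _ _ => Commute.all _ _
    exact Function.LeftInverse.injective φ.commutes
  exact Algebra.TensorProduct.includeLeft_injective (S := ℝ) hι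

/-! ### The Schouten square as a cyclic sum. -/

section Perm

variable {ι 𝒪 : Type*} [CommRing 𝒪]

theorem sum_sign_smul_perm_fin_three (F : ι → ι → ι → 𝒪) (i : Fin 3 → ι) :
    ∑ σ : Equiv.Perm (Fin 3), (Equiv.Perm.sign σ : ℤ) • F (i (σ 0)) (i (σ 1)) (i (σ 2)) =
      F (i 0) (i 1) (i 2) - F (i 1) (i 0) (i 2) - F (i 2) (i 1) (i 0) - F (i 0) (i 2) (i 1) +
        F (i 1) (i 2) (i 0) + F (i 2) (i 0) (i 1) := by
  have h : (Finset.univ : Finset (Equiv.Perm (Fin 3))) =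
      {1, Equiv.swap 0 1, Equiv.swap 0 2, Equiv.swap 1 2, Equiv.swap 0 1 * Equiv.swap 1 2,
        Equiv.swap 1 2 * Equiv.swap 0 1} := by decide
  rw [h, Finset.sum_insert (by decide), Finset.sum_insert (by decide),
    Finset.sum_insert (by decide), Finset.sum_insert (by decide), Finset.sum_insert (by decide),
    Finset.sum_singleton]
  simp [Equiv.swap_apply_def]
  abel

/-- Permutations differing by a swap of the last two indices contribute equally, so the six terms
are twice the cyclic sum. -/
theorem half_schouten_eq_jacobiator [Fintype ι] [Algebra ℝ 𝒪] (d : ι → Derivation ℝ 𝒪 𝒪)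
    {P : ι → ι → 𝒪} (hP : ∀ i j, P j i = -P i j) (i : Fin 3 → ι) :
    (1 / 2 : ℝ) • ∑ σ : Equiv.Perm (Fin 3), (Equiv.Perm.sign σ : ℤ) •
      ∑ l, P (i (σ 0)) l * d l (P (i (σ 1)) (i (σ 2))) =
    jacobiator d P (i 0) (i 1) (i 2) := by
  have hG : ∀ i j k, ∑ l, P i l * d l (P k j) = -∑ l, P i l * d l (P j k) := fun i j k => by
    simp only [hP j k, map_neg, mul_neg, Finset.sum_neg_distrib]
  rw [sum_sign_smul_perm_fin_three fun i j k => ∑ l, P i l * d l (P j k)]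
  simp only [jacobiator, Finset.sum_add_distrib]
  rw [hG (i 0) (i 1), hG (i 1) (i 2), hG (i 2) (i 0)]
  module

end Perm


/-! ### Vanishing of Q₊² in one coordinate domain. -/

variable {n : ℕ} {U : Opens (Coords n)}

/-- The coordinate function `xⁱ` on `U`. -/
def coordFun (U : Opens (Coords n)) (i : Fin n) : SmoothFun U :=
  SmoothFun.ofContDiffOn (EuclideanSpace.proj i : Coords n →L[ℝ] ℝ)
    (ContinuousLinearMap.contDiff _).contDiffOn

theorem SmoothFun.pd_ofContDiffOn (i : Fin n) (g : Coords n → ℝ) (hg : ContDiffOn ℝ ∞ g U) (u : U) :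
    (SmoothFun.pd i (SmoothFun.ofContDiffOn g hg) : U → ℝ) u = fderiv ℝ g u (coordVec i) := by
  rw [SmoothFun.pd_apply, SmoothFun.fderiv_ext_congr _ g u fun v => rfl]

theorem pd_coordFun (i j : Fin n) :
    SmoothFun.pd j (coordFun U i) = if j = i then 1 else 0 := by
  ext u
  rw [coordFun, SmoothFun.pd_ofContDiffOn, ContinuousLinearMap.fderiv, coordVec]
  split_ifs with h
  · subst h; simp
  · simp [Ne.symm h]

/-- Exhibits the x-component as a value of the operator, so that a vanishing square gives
information about it. -/
theorem SuperVectorField.act_coordFun (V : SuperVectorField U) (i : Fin n) :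
    V.act (base (coordFun U i)) = V.X i := by
  rw [act_base]
  simp [pd_coordFun]

section Homological

variable {P : Fin n → Fin n → SmoothFun U} {R S : Fin n → Fin n → Fin n → SmoothFun U}
  {H : Fin n → Fin n → Fin n → Fin n → SmoothFun U}
variable (hP : ∀ i j, P j i = -P i j)
  (hS : ∀ i j k, S j i k = -S i j k) (hS' : ∀ i j k, S i k j = -S i j k)
include hP hS hS'

omit hS hS' in
theorem Qplus_act_coeffHom (f : SmoothFun U) : (Qplus P R S H).act (coeffHom U f) =
    lin (coeffHom U) (fun l => SmoothFun.pd l f) (fun l => -shiftedY P l) := by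
  rw [coeffHom_apply, SuperVectorField.act_base]
  simp only [Qplus_X hP]
  refine Finset.sum_congr rfl fun l _ => ?_
  rw [coeffHom_mul_comm, coeffHom_apply]

theorem Qplus_act_X (i : Fin n) : (Qplus P R S H).act ((Qplus P R S H).X i) =
    (1 / 2 : ℝ) • quad (coeffHom U) (fun j k => jacobiator (partialDeriv U) P i j k -
      (R i j k + contraction P S i j k)) (a U) (a U) := by
  have hV : (Qplus P R S H).HasDegreeOne := Qplus_hasDegreeOne hP hS hS'
  rw [Qplus_X hP]
  exact oddDeriv_component_x (𝒪 := SmoothFun U) (𝒜 := SuperFun U) (b := coeffHom U)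
    (d := partialDeriv U) (Q := (Qplus P R S H).act) (ε := parity U) (a := a U) (y := y U)
    (w := shiftedY P) (z := z U) (P := P) (S := S)
    (RC := fun i j k => R i j k + contraction P S i j k)
    (SuperVectorField.act_mul hV) parity_base (Qplus_act_coeffHom hP)
    (fun i => by rw [SuperVectorField.act_a, Qplus_A hP hS hS']; rfl) (fun i => rfl)
    antiComm_a_a hP antiComm_a_y (fun i => by rw [SuperVectorField.act_y, Qplus_Y hP hS']; rfl) i

theorem Qplus_act_A (hRC : ∀ i j k, jacobiator (partialDeriv U) P i j k =
      R i j k + contraction P S i j k) (i : Fin n) :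
    (Qplus P R S H).act ((Qplus P R S H).A i) =
    (1 / 6 : ℝ) • cub (coeffHom U) (fun j k l => H i j k l + (SmoothFun.pd i (S j k l)
      - SmoothFun.pd j (S i k l) + SmoothFun.pd k (S i j l) - SmoothFun.pd l (S i j k)))
      (shiftedY P) (shiftedY P) (shiftedY P) := by
  have hV : (Qplus P R S H).HasDegreeOne := Qplus_hasDegreeOne hP hS hS'
  have hQw : ∀ i, (Qplus P R S H).act (shiftedY P i) = 0 := fun i => by
    have := Qplus_act_X (R := R) (H := H) hP hS hS' i
    rw [Qplus_X hP, map_neg] at this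
    rw [← neg_eq_zero, this]
    simp only [hRC, sub_self]
    simp [quad]
  rw [Qplus_A hP hS hS']
  exact oddDeriv_component_a (𝒪 := SmoothFun U) (𝒜 := SuperFun U) (b := coeffHom U)
    (d := partialDeriv U) (Q := (Qplus P R S H).act) (ε := parity U) (a := a U) (y := y U)
    (w := shiftedY P) (z := z U) (P := P) (S := S)
    (SuperVectorField.act_mul hV) parity_base (Qplus_act_coeffHom hP)
    (fun i => by rw [SuperVectorField.act_a, Qplus_A hP hS hS']; rfl) (fun i => rfl)
    antiComm_a_a hP SmoothFun.pd_comm antiComm_a_shiftedY antiComm_shiftedY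
    (fun j k => mul_comm_of_mem_degreePart_two (z_mem_degreePart j) _)
    (fun j k => by
      rw [SuperVectorField.act_a]
      exact mul_comm_of_mem_degreePart_two (hV j).2.1 _)
    (fun i => parity_of_mem_degreePart_one (a_mem_degreePart i))
    (fun i => parity_of_mem_degreePart_one (shiftedY_mem_degreePart i)) hQw
    (H := H) (fun i => by
      rw [SuperVectorField.act_z, Qplus_Z hP hS hS']
      simp only [hRC]
      rfl) i

theorem Qplus_isHomological (hRC : ∀ i j k, jacobiator (partialDeriv U) P i j k =
      R i j k + contraction P S i j k)
    (hdS : ∀ i j k l, H i j k l + (SmoothFun.pd i (S j k l)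
      - SmoothFun.pd j (S i k l) + SmoothFun.pd k (S i j l) - SmoothFun.pd l (S i j k)) = 0) :
    (Qplus P R S H).IsHomological := by
  have hV : (Qplus P R S H).HasDegreeOne := Qplus_hasDegreeOne hP hS hS'
  refine ⟨hV, ?_⟩
  have hX : ∀ i, (Qplus P R S H).act ((Qplus P R S H).X i) = 0 := fun i => by
    rw [Qplus_act_X hP hS hS']
    simp only [hRC, sub_self]
    simp [quad]
  have hA : ∀ i, (Qplus P R S H).act ((Qplus P R S H).A i) = 0 := fun i => by
    rw [Qplus_act_A hP hS hS' hRC]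
    simp only [hdS]
    simp [cub]
  set D := (Qplus P R S H).act ∘ₗ (Qplus P R S H).act with hD
  have hDmul : ∀ F G, D (F * G) = D F * G + F * D G := SuperVectorField.act_act_mul hV
  have hDb : ∀ f, D (coeffHom U f) = 0 := SuperVectorField.act_act_base hV hX
  have hDa : ∀ i, D (a U i) = 0 := fun i => by
    rw [hD, LinearMap.comp_apply, SuperVectorField.act_a, hA]
  -- Q₊² kills Q₊x = -w because Q₊(Q₊²x) = 0; subtracting Πa then gives y. The same device applied
  -- to Q₊a below gives z.
  have hDw : ∀ i, D (shiftedY P i) = 0 := fun i => by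
    have h : D ((Qplus P R S H).X i) = 0 := by rw [hD, LinearMap.comp_apply, hX, map_zero]
    rwa [Qplus_X hP, map_neg, neg_eq_zero] at h
  have hDy : ∀ i, D (y U i) = 0 := fun i => by
    have h := hDw i
    have hl : D (lin (coeffHom U) (P i) (a U)) = 0 :=
      deriv_lin_eq_zero (𝒪 := SmoothFun U) (𝒜 := SuperFun U) hDmul hDb hDa _
    rw [shiftedY_eq, map_add, hl, add_zero] at h
    exact h
  have hDz : ∀ i, D (z U i) = 0 := fun i => by
    have h : D ((Qplus P R S H).A i) = 0 := by rw [hD, LinearMap.comp_apply, hA, map_zero]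
    have ha : D (quad (coeffHom U) (fun j k => SmoothFun.pd i (P j k)) (a U) (a U)) = 0 :=
      deriv_quad_eq_zero (𝒪 := SmoothFun U) (𝒜 := SuperFun U) hDmul hDb hDa hDa _
    have hw : D (quad (coeffHom U) (S i) (shiftedY P) (shiftedY P)) = 0 :=
      deriv_quad_eq_zero (𝒪 := SmoothFun U) (𝒜 := SuperFun U) hDmul hDb hDw hDw _
    rw [Qplus_A hP hS hS', map_add, map_sub, map_smul, map_smul, ha, hw, smul_zero,
      sub_zero, add_zero] at h
    exact h
  refine LinearMap.ext fun F => ?_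
  rw [LinearMap.zero_apply]
  induction F using SuperFun.coordinate_induction with
  | base f => exact hDb f
  | a i => exact hDa i
  | y i => exact hDy i
  | z i => exact hDz i
  | add F G hF hG => rw [map_add, hF, hG, add_zero]
  | mul F G hF hG => rw [hDmul, hF, hG, zero_mul, mul_zero, add_zero]

theorem jacobiator_eq_of_act_comp_act_eq_zero
    (hR : ∀ i j k, R i k j = -R i j k)
    (hQ : (Qplus P R S H).act ∘ₗ (Qplus P R S H).act = 0) (i j k : Fin n) :
    jacobiator (partialDeriv U) P i j k = R i j k + contraction P S i j k := by
  have h : (Qplus P R S H).act ((Qplus P R S H).X i) = 0 := by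
    rw [← SuperVectorField.act_coordFun]
    exact LinearMap.congr_fun hQ _
  rw [Qplus_act_X hP hS hS', smul_eq_zero] at h
  have h := h.resolve_left (by norm_num)
  have h2 (j k) : contraction P S i k j = -contraction P S i j k :=
    sum_contraction_swap P (S := S) hS' i j k
  have hT : ∀ j k, jacobiator (partialDeriv U) P i k j - (R i k j + contraction P S i k j) =
      -(jacobiator (partialDeriv U) P i j k - (R i j k + contraction P S i j k)) := fun j k => by
    rw [jacobiator_swap (partialDeriv U) hP, h2, hR]
    abel
  have h0 := eq_zero_of_quad_eq_zero (𝒪 := SmoothFun U) (𝒜 := SuperFun U)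
    (b := coeffHom U) (ε := parity U) (v := a U) (s := j) (s' := k) (D := da U j)
    (T := fun j k => jacobiator (partialDeriv U) P i j k - (R i j k + contraction P S i j k))
    (dodd_mul (Sum.inl j)) parity_base (dodd_base (Sum.inl j)) (da_a j) base_injective
    (D' := da U k) (dodd_mul (Sum.inl k)) (dodd_base (Sum.inl k)) (da_a k)
    (fun i => parity_of_mem_degreePart_one (a_mem_degreePart i)) hT h
  exact sub_eq_zero.1 h0

/-- The bivector equation enters as a hypothesis because the cubic formula for Q₊²a is only
available once Q₊w = 0. -/
theorem extDeriv_eq_of_act_comp_act_eq_zero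
    (hRC : ∀ i j k, jacobiator (partialDeriv U) P i j k = R i j k + contraction P S i j k)
    (hH : ∀ i j k l, H i k j l = -H i j k l) (hH' : ∀ i j k l, H i j l k = -H i j k l)
    (hQ : (Qplus P R S H).act ∘ₗ (Qplus P R S H).act = 0) (i j k l : Fin n) :
    H i j k l + (SmoothFun.pd i (S j k l) - SmoothFun.pd j (S i k l) + SmoothFun.pd k (S i j l)
      - SmoothFun.pd l (S i j k)) = 0 := by
  have h : (Qplus P R S H).act ((Qplus P R S H).A i) = 0 := by
    rw [← SuperVectorField.act_a]
    exact LinearMap.congr_fun hQ _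
  rw [Qplus_act_A hP hS hS' hRC, smul_eq_zero] at h
  have h := h.resolve_left (by norm_num)
  have hw : ∀ j k, dy U j (shiftedY P k) = if j = k then 1 else 0 := fun j k => by
    have h0 : dy U j (lin (coeffHom U) (P k) (a U)) = 0 := by
      rw [lin, map_sum]
      refine Finset.sum_eq_zero fun l _ => ?_
      have h1 : dy U j (coeffHom U (P k l)) = 0 := dodd_base _ _
      have h2 : dy U j (coeffHom U (P k l) * a U l) = dy U j (coeffHom U (P k l)) * a U l +
        parity U (coeffHom U (P k l)) * dy U j (a U l) := dodd_mul _ _ _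
      rw [h2, h1, dy_a, zero_mul, mul_zero, add_zero]
    rw [shiftedY_eq, map_add, dy_y, h0, add_zero]
  refine eq_zero_of_cub_eq_zero (𝒪 := SmoothFun U) (𝒜 := SuperFun U)
    (b := coeffHom U) (ε := parity U) (v := shiftedY P) (s := j) (s' := k) (s'' := l)
    (D := dy U j) (dodd_mul (Sum.inr j)) parity_base
    (dodd_base (Sum.inr j)) (hw j) base_injective (D' := dy U k) (D'' := dy U l)
    (dodd_mul (Sum.inr k)) (dodd_base (Sum.inr k)) (hw k)
    (dodd_mul (Sum.inr l)) (dodd_base (Sum.inr l)) (hw l)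
    (fun i => parity_of_mem_degreePart_one (shiftedY_mem_degreePart i))
    (fun j k l => ?_) (fun j k l => ?_) h
  -- For fixed i only alternation of H + dS in the last three indices is needed, as i is the free
  -- index of Q₊²a_i.
  · rw [hH, hS j k l, hS' i j k, map_neg, map_neg]
    ring
  · rw [hH', hS' j k l, hS' i k l, map_neg, map_neg]
    ring

end Homological


/-! ### Components of multivector fields and forms in a chart. -/

section Manifold

variable {n : ℕ} {M : Type*} [TopologicalSpace M] [ChartedSpace (Coords n) M]

theorem MultivectorField.comp_comp_swap {k : ℕ} (V : MultivectorField n M k)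
    (e : IsManifold.maximalAtlas (𝓡 n) ∞ M) (i : Fin k → Fin n) {p q : Fin k} (hpq : p ≠ q) :
    V.comp e (i ∘ Equiv.swap p q) = -V.comp e i := by
  ext u
  exact (V.toFun (e.1.symm u)).map_swap (fun r => coordCovector e.1 u (i r)) hpq

theorem DifferentialForm.comp_comp_swap {k : ℕ} (β : DifferentialForm n M k)
    (e : IsManifold.maximalAtlas (𝓡 n) ∞ M) (i : Fin k → Fin n) {p q : Fin k} (hpq : p ≠ q) :
    β.comp e (i ∘ Equiv.swap p q) = -β.comp e i := by
  ext u
  exact (formInChart β.toFun e.1 u).toAlternatingMap.map_swap (fun r => coordVec (i r)) hpq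

theorem MultivectorField.comp_two_swap (V : MultivectorField n M 2)
    (e : IsManifold.maximalAtlas (𝓡 n) ∞ M) (i j : Fin n) :
    V.comp e ![j, i] = -V.comp e ![i, j] := by
  rw [← V.comp_comp_swap e ![i, j] (zero_ne_one : (0 : Fin 2) ≠ 1)]
  congr 1
  ext r
  fin_cases r <;> rfl

theorem MultivectorField.comp_three_swap_right (V : MultivectorField n M 3)
    (e : IsManifold.maximalAtlas (𝓡 n) ∞ M) (i j k : Fin n) :
    V.comp e ![i, k, j] = -V.comp e ![i, j, k] := by
  rw [← V.comp_comp_swap e ![i, j, k] (by decide : (1 : Fin 3) ≠ 2)]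
  congr 1
  ext r
  fin_cases r <;> rfl

theorem DifferentialForm.comp_three_swap_left (β : DifferentialForm n M 3)
    (e : IsManifold.maximalAtlas (𝓡 n) ∞ M) (i j k : Fin n) :
    β.comp e ![j, i, k] = -β.comp e ![i, j, k] := by
  rw [← β.comp_comp_swap e ![i, j, k] (by decide : (0 : Fin 3) ≠ 1)]
  congr 1
  ext r
  fin_cases r <;> rfl

theorem DifferentialForm.comp_three_swap_right (β : DifferentialForm n M 3)
    (e : IsManifold.maximalAtlas (𝓡 n) ∞ M) (i j k : Fin n) :
    β.comp e ![i, k, j] = -β.comp e ![i, j, k] := by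
  rw [← β.comp_comp_swap e ![i, j, k] (by decide : (1 : Fin 3) ≠ 2)]
  congr 1
  ext r
  fin_cases r <;> rfl

theorem DifferentialForm.comp_four_swap_mid (β : DifferentialForm n M 4)
    (e : IsManifold.maximalAtlas (𝓡 n) ∞ M) (i j k l : Fin n) :
    β.comp e ![i, k, j, l] = -β.comp e ![i, j, k, l] := by
  rw [← β.comp_comp_swap e ![i, j, k, l] (by decide : (1 : Fin 4) ≠ 2)]
  congr 1
  ext r
  fin_cases r <;> rfl

theorem DifferentialForm.comp_four_swap_right (β : DifferentialForm n M 4)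
    (e : IsManifold.maximalAtlas (𝓡 n) ∞ M) (i j k l : Fin n) :
    β.comp e ![i, j, l, k] = -β.comp e ![i, j, k, l] := by
  rw [← β.comp_comp_swap e ![i, j, k, l] (by decide : (2 : Fin 4) ≠ 3)]
  congr 1
  ext r
  fin_cases r <;> rfl

theorem DifferentialForm.comp_apply {k : ℕ} (β : DifferentialForm n M k)
    (e : IsManifold.maximalAtlas (𝓡 n) ∞ M) (i : Fin k → Fin n) (u : chartImage e.1) :
    (β.comp e i : chartImage e.1 → ℝ) u = formInChart β.toFun e.1 u fun r => coordVec (i r) := rfl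

/-- The components of the exterior derivative of a form in a chart. -/
theorem DifferentialForm.extDeriv_formInChart_apply {k : ℕ} (β : DifferentialForm n M k)
    (e : IsManifold.maximalAtlas (𝓡 n) ∞ M) (u : chartImage e.1) (i : Fin (k + 1) → Fin n) :
    extDeriv (formInChart β.toFun e.1) (u : Coords n) (fun r => coordVec (i r)) =
      ∑ p : Fin (k + 1), (-1 : ℤ) ^ (p : ℕ) •
        (SmoothFun.pd (i p) (β.comp e (p.removeNth i)) : chartImage e.1 → ℝ) u := by
  have hd : DifferentiableAt ℝ (formInChart β.toFun e.1) (u : Coords n) :=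
    ((β.smooth e.1 e.2).contDiffAt (e.1.open_target.mem_nhds u.2)).differentiableAt (by simp)
  rw [extDeriv_apply hd]
  refine Finset.sum_congr rfl fun p _ => ?_
  congr 1
  exact (SmoothFun.pd_ofContDiffOn (i p) _ _ u).symm

theorem DifferentialForm.extDeriv_formInChart_three (β : DifferentialForm n M 3)
    (e : IsManifold.maximalAtlas (𝓡 n) ∞ M) (u : chartImage e.1) (i : Fin 4 → Fin n) :
    extDeriv (formInChart β.toFun e.1) (u : Coords n) (fun r => coordVec (i r)) =
      ((SmoothFun.pd (i 0) (β.comp e ![i 1, i 2, i 3]) -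
        SmoothFun.pd (i 1) (β.comp e ![i 0, i 2, i 3]) +
        SmoothFun.pd (i 2) (β.comp e ![i 0, i 1, i 3]) -
        SmoothFun.pd (i 3) (β.comp e ![i 0, i 1, i 2]) : SmoothFun (chartImage e.1)) :
        chartImage e.1 → ℝ) u := by
  have h0 : (0 : Fin 4).removeNth i = ![i 1, i 2, i 3] := by
    ext r; fin_cases r <;> rfl
  have h1 : (1 : Fin 4).removeNth i = ![i 0, i 2, i 3] := by
    ext r; fin_cases r <;> rfl
  have h2 : (2 : Fin 4).removeNth i = ![i 0, i 1, i 3] := by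
    ext r; fin_cases r <;> rfl
  have h3 : (3 : Fin 4).removeNth i = ![i 0, i 1, i 2] := by
    ext r; fin_cases r <;> rfl
  rw [β.extDeriv_formInChart_apply, Fin.sum_univ_four, h0, h1, h2, h3]
  simp
  ring

/-- An alternating form is determined by its values on the coordinate basis, so the pointwise
equation dS = -H amounts to equations between components. -/
theorem DifferentialForm.extDeriv_eq_neg_iff (S : DifferentialForm n M 3)
    (H : DifferentialForm n M 4) (e : IsManifold.maximalAtlas (𝓡 n) ∞ M) :
    (∀ u ∈ e.1.target, extDeriv (formInChart S.toFun e.1) u = -formInChart H.toFun e.1 u) ↔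
      ∀ i j k l, H.comp e ![i, j, k, l] + (SmoothFun.pd i (S.comp e ![j, k, l])
      - SmoothFun.pd j (S.comp e ![i, k, l]) + SmoothFun.pd k (S.comp e ![i, j, l])
      - SmoothFun.pd l (S.comp e ![i, j, k])) = 0 := by
  constructor
  · intro h i j k l
    ext u
    have h1 := S.extDeriv_formInChart_three e u ![i, j, k, l]
    rw [h u u.2] at h1
    have h2 := H.comp_apply e ![i, j, k, l] u
    rw [ContinuousAlternatingMap.neg_apply, ← h2] at h1
    exact (neg_eq_iff_add_eq_zero.1 h1)
  · intro h u hu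
    refine ContinuousAlternatingMap.toAlternatingMap_injective ?_
    refine Module.Basis.ext_alternating (EuclideanSpace.basisFun (Fin n) ℝ).toBasis
      fun i _ => ?_
    have e1 : (fun r => (EuclideanSpace.basisFun (Fin n) ℝ).toBasis (i r)) =
        fun r => coordVec (i r) := by
      ext1 r
      simp [coordVec]
    rw [e1]
    have h1 := S.extDeriv_formInChart_three e ⟨u, hu⟩ i
    refine h1.trans ?_
    have h2 := congrArg (fun f : SmoothFun (chartImage e.1) => (f : chartImage e.1 → ℝ) ⟨u, hu⟩)
      (h (i 0) (i 1) (i 2) (i 3))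
    have h3 := H.comp_apply e i ⟨u, hu⟩
    have h4 : ![i 0, i 1, i 2, i 3] = i := by
      ext r; fin_cases r <;> rfl
    rw [h4] at h2
    refine (eq_neg_of_add_eq_zero_right h2).trans ?_
    rw [h3]
    rfl

end Manifold

end BiTwisted

end

theorem mainTheorem5 {n : ℕ} {M : Type*} [TopologicalSpace M]
    [ChartedSpace (EuclideanSpace ℝ (Fin n)) M] [IsManifold (𝓡 n) ∞ M]
    (P : BiTwisted.MultivectorField n M 2) (R : BiTwisted.MultivectorField n M 3)
    (S : BiTwisted.DifferentialForm n M 3) (H : BiTwisted.DifferentialForm n M 4) :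
    BiTwisted.IsQManifold P R S H ↔ BiTwisted.IsBiTwistedRPoisson P R S H := by
  have hJ (e : IsManifold.maximalAtlas (𝓡 n) ∞ M) (i j k : Fin n) :
      (1 / 2 : ℝ) • BiTwisted.schoutenSquare (fun i j => P.comp e ![i, j]) ![i, j, k] =
      BiTwisted.jacobiator (BiTwisted.partialDeriv (BiTwisted.chartImage e.1))
        (fun i j => P.comp e ![i, j]) i j k :=
    BiTwisted.half_schouten_eq_jacobiator (BiTwisted.partialDeriv (BiTwisted.chartImage e.1))
      (P := fun i j => P.comp e ![i, j]) (fun i j => P.comp_two_swap e i j) ![i, j, k]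
  constructor
  · intro h
    -- The bivector equation comes first, from Q₊²x = 0; the equation for dS relies on it.
    have hRC (e : IsManifold.maximalAtlas (𝓡 n) ∞ M) :=
      BiTwisted.jacobiator_eq_of_act_comp_act_eq_zero
        (P.comp_two_swap e) (S.comp_three_swap_left e) (S.comp_three_swap_right e)
        (R.comp_three_swap_right e) (h e).2
    refine ⟨fun e i j k => (hJ e i j k).trans (hRC e i j k), fun e => ?_⟩
    rw [S.extDeriv_eq_neg_iff H e]
    exact BiTwisted.extDeriv_eq_of_act_comp_act_eq_zero (P.comp_two_swap e)
      (S.comp_three_swap_left e) (S.comp_three_swap_right e) (hRC e)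
      (H.comp_four_swap_mid e) (H.comp_four_swap_right e) (h e).2
  · intro h e
    exact BiTwisted.Qplus_isHomological (P.comp_two_swap e)
      (S.comp_three_swap_left e) (S.comp_three_swap_right e)
      (fun i j k => (hJ e i j k).symm.trans (h.half_schouten e i j k))
      ((S.extDeriv_eq_neg_iff H e).1 (h.extDeriv_eq e))
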